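/- Let $\alpha\in(0,1)$. For $0\le y\le p$ put $$M_1(p,y)=\frac1{\Gamma(1-\alpha)}\int_y^p\bigl(1-p^{-2/\alpha}\mu^{2/\alpha}\bigr)^{-\alpha}d\mu,\qquad M_n(p,y)=\int_y^p M_1(a,y)\,M_{n-1}(p,a)\,da\quad(n\ge2),$$ $$N(p,y)=\sum_{n=1}^\infty M_n(p,y),\qquad H(p,x)=1+\int_x^pN(p,y)\,dy\quad(0\le x\le p),$$ and, for $c_1>0$ and $0\le y\le c_1$, $G_{c_1}(y)=\frac1{\Gamma(1-\alpha)}\int_y^{c_1}\bigl(1-c_1^{-2/\alpha}\mu^{2/\alpha}\bigr)^{-\alpha}d\mu$. For every $R>0$ the series defining $N$ converges uniformly on $\{(p,y):0\le y\le p\le R\}$, and all $M_n$ and $N$ are positive on $\{(p,y):0\le y<p\}$. For every $\beta>0$ there are $c_1=c_1(\alpha,\beta)>0$ and a pair $(u,s)$, with $s:[0,\infty)\to[0,\infty)$ continuous and strictly increasing, $s(0)=0$, such that, with $U=\{(x,t): t>0,\ 0<x<s(t)\}$ and $D^\alpha_{s^{-1}(x)}u(x,t)=\frac1{\Gamma(1-\alpha)}\int_{s^{-1}(x)}^t(t-\tau)^{-\alpha}u_t(x,\tau)\,d\tau$,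 $u$ is continuous on $\{(x,t): t>0,\ 0\le x\le s(t)\}$, all derivatives and integrals below exist, and $$D^\alpha_{s^{-1}(x)}u(x,t)=u_{xx}(x,t)-\frac{1}{\Gamma(1-\alpha)}\bigl(t-s^{-1}(x)\bigr)^{-\alpha}\quad\text{in }U,$$ $$u(s(t),t)=0,\qquad u_x(0,t)=-\beta t^{-\alpha/2}\qquad(t>0),$$ $$\dot s(t)=-\frac1{\Gamma(\alpha)}\lim_{a\nearrow s(t)}\frac{d}{dt}\int_{s^{-1}(a)}^t(t-\tau)^{\alpha-1}u_x(a,\tau)\,d\tau\qquad(t>0).$$ Moreover: - $s(t)=c_1t^{\alpha/2}$ for $t\ge 0$, and $u(x,t)=\int_{xt^{-\alpha/2}}^{c_1}H(p,xt^{-\alpha/2})\,G_{c_1}(p)\,dp$ for $t>0$, $0\le x\le s(t)$; - $u>0$ in $U$; - $u(x,t)=u(\lambda^ax,\lambda^{2a/\alpha}t)$ for all $a,\lambda>0$ and all $t>0$, $0\le x\le s(t)$; - $u_x(s(t),t)=0$ for $t>0$, both as a one-sided derivative and as the limit of $u_x(x,t)$ for $x\nearrow s(t)$; - $u(\cdot,t)\in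 W^{2,1}(0,s(t))$, $u_t(\cdot,t)\in L^1(0,s(t))$ and $D^\alpha_{s^{-1}(\cdot)}u(\cdot,t)\in L^1(0,s(t))$ for every $t>0$; - $u_t(x,\cdot)\in C([s^{-1}(x),\infty))$ and $u_x(x,\cdot)\in L^\infty(s^{-1}(x),\infty)\cap AC_{loc}([s^{-1}(x),\infty))$ for every $x>0$; - for every $t^*>0$ the following hold. (A1) $\dot s>0$ on $(0,t^*]$. (A2) $s\in AC[0,t^*]$; $u_x(x,\cdot)\in AC[s^{-1}(x),t^*]$ for $0<x\le s(t^*)$; and for each $t\in(0,t^*)$, $u_x(\cdot,t)\in AC[0,s(t)-\varepsilon]$ for all $\varepsilon\in(0,s(t))$ and $u_t(\cdot,t)\in L^1(0,s(t))$. (A3) $\dot s\in L^\infty_{loc}((0,t^*])$ and $D^\alpha_{s^{-1}(\cdot)}u(\cdot,t)\in L^1(0,s(t))$ for $t\in(0,t^*)$. -/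

import Mathlib

open Set Filter Topology MeasureTheory
open scoped ENNReal ContDiff

noncomputable section

namespace FracStefan

/-! ### Explicit kernels of the self-similar solution -/

/-- `M₁(p,y) = 1/Γ(1-α) ∫_y^p (1 - p^{-2/α} μ^{2/α})^{-α} dμ`. -/
def M₁ (α p y : ℝ) : ℝ :=
  1 / Real.Gamma (1 - α) *
    ∫ μ in y..p, (1 - p ^ (-(2 / α)) * μ ^ (2 / α)) ^ (-α)

/-- The iterated kernels `M n`, `n ≥ 1`: `M 1 = M₁` and
`M n (p,y) = ∫_y^p M₁(a,y) M_{n-1}(p,a) da` for `n ≥ 2`. The value at `n = 0` is not used. -/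
def M (α : ℝ) : ℕ → ℝ → ℝ → ℝ
  | 0, _, _ => 0
  | 1, p, y => M₁ α p y
  | n + 2, p, y => ∫ a in y..p, M₁ α a y * M α (n + 1) p a

/-- `N(p,y) = ∑_{n ≥ 1} M n (p,y)`. -/
def N (α p y : ℝ) : ℝ := ∑' n : ℕ, M α (n + 1) p y

/-- `H(p,x) = 1 + ∫_x^p N(p,y) dy`. -/
def H (α p x : ℝ) : ℝ := 1 + ∫ y in x..p, N α p y

/-- `G_c(y) = 1/Γ(1-α) ∫_y^c (1 - c^{-2/α} μ^{2/α})^{-α} dμ`. -/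
def G (α c y : ℝ) : ℝ :=
  1 / Real.Gamma (1 - α) *
    ∫ μ in y..c, (1 - c ^ (-(2 / α)) * μ ^ (2 / α)) ^ (-α)

/-! ### The moving domain, derivatives, and the fractional derivative

Throughout, `s` is the interface (with `s 0 = 0`) and `u x t` is the temperature at position `x`
and time `t`. -/

/-- The liquid domain `{(x,t) : t > 0, 0 < x < s(t)}`. -/
def U (s : ℝ → ℝ) : Set (ℝ × ℝ) := {q | 0 < q.2 ∧ 0 < q.1 ∧ q.1 < s q.2}

/-- The liquid domain together with its lateral boundaries: `{(x,t) : t > 0, 0 ≤ x ≤ s(t)}`. -/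
def Uclosed (s : ℝ → ℝ) : Set (ℝ × ℝ) := {q | 0 < q.2 ∧ 0 ≤ q.1 ∧ q.1 ≤ s q.2}

/-- The inverse of the interface function `s : [0,∞) → ℝ`. -/
def sInv (s : ℝ → ℝ) (x : ℝ) : ℝ := Function.invFunOn s (Ici 0) x

/-- `u_x(x,t)`: derivative in space of `u(·,t)` on `[0, s(t)]` (one-sided at the two ends). -/
def ux (u : ℝ → ℝ → ℝ) (s : ℝ → ℝ) (x t : ℝ) : ℝ :=
  derivWithin (fun y => u y t) (Icc 0 (s t)) x

/-- `u_t(x,t)`: derivative in time of `u(x,·)` on `[s⁻¹(x), ∞)` (one-sided at `s⁻¹(x)`). -/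
def ut (u : ℝ → ℝ → ℝ) (s : ℝ → ℝ) (x t : ℝ) : ℝ :=
  derivWithin (fun τ => u x τ) (Ici (sInv s x)) t

/-- The Caputo derivative started at the melting time,
`D^α_{s⁻¹(x)} u(x,t) = 1/Γ(1-α) ∫_{s⁻¹(x)}^t (t-τ)^{-α} u_t(x,τ) dτ`. -/
def caputo (α : ℝ) (u : ℝ → ℝ → ℝ) (s : ℝ → ℝ) (x t : ℝ) : ℝ :=
  1 / Real.Gamma (1 - α) * ∫ τ in (sInv s x)..t, (t - τ) ^ (-α) * ut u s x τ

/-- `r ↦ ∫_{s⁻¹(a)}^r (r-τ)^{α-1} u_x(a,τ) dτ`. -/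
def fluxInt (α : ℝ) (u : ℝ → ℝ → ℝ) (s : ℝ → ℝ) (a r : ℝ) : ℝ :=
  ∫ τ in (sInv s a)..r, (r - τ) ^ (α - 1) * ux u s a τ

/-! ### The free boundary problem -/

/-- `(u,s)` solves the time-fractional one-phase Stefan problem with `s(0) = 0`, apart from the
condition on the fixed boundary `x = 0`. All the derivatives and integrals
that occur are required to exist. -/
structure IsStefanSolution (α : ℝ) (u : ℝ → ℝ → ℝ) (s : ℝ → ℝ) : Prop where
  s_zero : s 0 = 0
  s_cont : ContinuousOn s (Ici 0)
  s_mono : StrictMonoOn s (Ici 0)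
  s_diff : ∀ t, 0 < t → DifferentiableAt ℝ s t
  u_cont : ContinuousOn (fun q : ℝ × ℝ => u q.1 q.2) (Uclosed s)
  diff_x : ∀ x t, (x, t) ∈ U s → DifferentiableAt ℝ (fun y => u y t) x
  diff_xx : ∀ x t, (x, t) ∈ U s → DifferentiableAt ℝ (fun y => ux u s y t) x
  diff_t : ∀ x t, (x, t) ∈ U s → DifferentiableAt ℝ (fun τ => u x τ) t
  caputo_int : ∀ x t, (x, t) ∈ U s →
    IntervalIntegrable (fun τ => (t - τ) ^ (-α) * ut u s x τ) volume (sInv s x) t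
  /-- `D^α_{s⁻¹(x)} u = u_xx - (t - s⁻¹(x))^{-α} / Γ(1-α)` in the liquid domain -/
  equation : ∀ x t, (x, t) ∈ U s →
    caputo α u s x t =
      deriv (fun y => ux u s y t) x - 1 / Real.Gamma (1 - α) * (t - sInv s x) ^ (-α)
  /-- `u(s(t),t) = 0` -/
  front : ∀ t, 0 < t → u (s t) t = 0
  flux_int : ∀ a t, (a, t) ∈ U s →
    IntervalIntegrable (fun τ => (t - τ) ^ (α - 1) * ux u s a τ) volume (sInv s a) t
  flux_diff : ∀ a t, (a, t) ∈ U s → DifferentiableAt ℝ (fluxInt α u s a) t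
  /-- `s'(t) = - 1/Γ(α) lim_{a ↗ s(t)} d/dt ∫_{s⁻¹(a)}^t (t-τ)^{α-1} u_x(a,τ) dτ` -/
  stefan : ∀ t, 0 < t →
    Tendsto (fun a => -(1 / Real.Gamma α) * deriv (fluxInt α u s a) t)
      (𝓝[<] (s t)) (𝓝 (deriv s t))

/-- The Neumann condition `u_x(0,t) = -β t^{-α/2}` for `t > 0`. -/
def Neumann (α β : ℝ) (u : ℝ → ℝ → ℝ) (s : ℝ → ℝ) : Prop :=
  ∀ t, 0 < t →
    HasDerivWithinAt (fun y => u y t) (-β * t ^ (-(α / 2))) (Icc 0 (s t)) 0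

/-! ### Function spaces -/

/-- `g` is a weak derivative of order `k` of `f` on the open interval `(a,b)`. -/
def IsWeakDeriv (k : ℕ) (a b : ℝ) (f g : ℝ → ℝ) : Prop :=
  ∀ φ : ℝ → ℝ, ContDiff ℝ ∞ φ → HasCompactSupport φ → tsupport φ ⊆ Ioo a b →
    ∫ x in Ioo a b, f x * iteratedDeriv k φ x = (-1) ^ k * ∫ x in Ioo a b, g x * φ x

/-- The Sobolev space `W^{k,p}(a,b)`: `f` and its weak derivatives of order at most `k` are in
`L^p(a,b)`. -/
def MemW (k : ℕ) (p : ℝ≥0∞) (a b : ℝ) (f : ℝ → ℝ) : Prop :=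
  MemLp f p (volume.restrict (Ioo a b)) ∧
    ∀ j ≤ k, ∃ g : ℝ → ℝ, MemLp g p (volume.restrict (Ioo a b)) ∧ IsWeakDeriv j a b f g

/-! ### The regularity assumptions (A1), (A2), (A3) on a time interval `[0,t*]`, for `s(0) = 0` -/

/-- (A1): `s'(t) > 0`. -/
def A1 (s : ℝ → ℝ) (tstar : ℝ) : Prop :=
  ∀ t ∈ Ioc 0 tstar, DifferentiableAt ℝ s t ∧ 0 < deriv s t

/-- (A2): `s ∈ AC[0,t*]`, `u_x(x,·) ∈ AC[s⁻¹(x),t*]`, `u_x(·,t) ∈ AC[0,s(t)-ε]`,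
`u_t(·,t) ∈ L¹(0,s(t))`. -/
def A2 (u : ℝ → ℝ → ℝ) (s : ℝ → ℝ) (tstar : ℝ) : Prop :=
  AbsolutelyContinuousOnInterval s 0 tstar ∧
  (∀ x, 0 < x → x ≤ s tstar →
    AbsolutelyContinuousOnInterval (fun τ => ux u s x τ) (sInv s x) tstar) ∧
  (∀ t ∈ Ioo 0 tstar, ∀ ε, 0 < ε → ε < s t →
    AbsolutelyContinuousOnInterval (fun x => ux u s x t) 0 (s t - ε)) ∧
  (∀ t ∈ Ioo 0 tstar, IntegrableOn (fun x => ut u s x t) (Ioo 0 (s t)))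

/-- (A3): `s' ∈ L^∞_loc((0,t*])` and `D^α_{s⁻¹(·)} u(·,t) ∈ L¹(0,s(t))`. -/
def A3 (α : ℝ) (u : ℝ → ℝ → ℝ) (s : ℝ → ℝ) (tstar : ℝ) : Prop :=
  (∀ K : Set ℝ, IsCompact K → K ⊆ Ioc 0 tstar → MemLp (deriv s) ∞ (volume.restrict K)) ∧
  (∀ t ∈ Ioo 0 tstar, IntegrableOn (fun x => caputo α u s x t) (Ioo 0 (s t)))

end FracStefan

end

/-! Look for `u(x,t) = f(z)` with `z = x t^(-α/2)` and `s(t) = c t^(α/2)`, and put `g = -f'`. Since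
`u_t = (α/2) x t^(-α/2-1) g(z)`, the substitution `p = x τ^(-α/2)` turns the Caputo derivative into
`t^(-α) ∫_z^c k(z/p) g(p) dp`, where `k` is `kernel`; the source term becomes `t^(-α) k(z/c)` and
`u_xx` becomes `-t^(-α) g'(z)`. The equation is therefore `-g'(z) = k(z/c) + ∫_z^c k(z/p) g(p) dp`.
Integrated from `z` to `c` with `g(c) = 0`, it is the Volterra equation `g(z) = M₁(c,z) + ∫_z^c
M₁(a,z) g(a) da`, whose solution is the Neumann series `g = N(c,·)`. Factorial bounds (`E_le`) give
locally uniform convergence. `resolvent_eq_left` is this Volterra equation and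
`hasDerivAt_resolvent` its differentiated form; `caputo_temp` and `kernel_front` translate it back
to `(x,t)`. The mirror identity `resolvent_eq_right`, integrated once more, yields the formula for
`u` with `H` and `G` (`integral_H_mul_G`).

The Stefan condition then holds for every `c > 0`. The fractional integral of `u_x(a,·)` is
`-r^(α/2) Φ(a r^(-α/2))`, with `Φ` the `fluxTransform` of `g`. The derivative of `g` blows up at
`c`, but only through the summand `M₁(c,·)`, whose transform is exactly `Γ(α)(c - z)` by a Beta
integral (`fluxTransform_E₁`). The rest of `g` is continuously differentiable across `c` and zero
beyond it, so its transform and the derivative of that transform vanish at `c`. Thus `Φ → 0` and `Φ'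
→ -Γ(α)` at the front, which gives `s' = (α/2) s/t`.

The constant `c` is left for the Neumann condition, which reads `N(c,0) = β` and is solved by the
intermediate value theorem. Regularity rests on the sign `g' ≤ 0`: a continuous monotone function
that is differentiable in the interior is absolutely continuous, however singular its derivative is
at the endpoints. -/

noncomputable section

namespace FracStefan

variable {α c : ℝ}

/-! ### The cut-off kernel and its primitive -/

/-- `v ↦ (1 - v^{2/α})^{-α} / Γ(1-α)` on `(0,1)`, extended by zero. -/
def kernel (α v : ℝ) : ℝ :=
  (Ioo (0 : ℝ) 1).indicator (fun v => 1 / Real.Gamma (1 - α) * (1 - v ^ (2 / α)) ^ (-α)) v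

/-- `v ↦ ∫_v^1 kernel`. -/
def kernelInt (α v : ℝ) : ℝ := ∫ w in v..1, kernel α w

/-- A continuous extension of `M₁` to the plane, vanishing for `p ≤ y`. -/
def E₁ (α p y : ℝ) : ℝ := max p 0 * kernelInt α (y / max p 0)

lemma gamma_one_sub_pos (hα₁ : α < 1) : 0 < Real.Gamma (1 - α) :=
  Real.Gamma_pos_of_pos (by linarith)

lemma kernel_of_mem {v : ℝ} (h : v ∈ Ioo (0 : ℝ) 1) :
    kernel α v = 1 / Real.Gamma (1 - α) * (1 - v ^ (2 / α)) ^ (-α) :=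
  indicator_of_mem h _

lemma kernel_of_notMem {v : ℝ} (h : v ∉ Ioo (0 : ℝ) 1) : kernel α v = 0 :=
  indicator_of_notMem h _

lemma kernel_of_one_le {v : ℝ} (h : 1 ≤ v) : kernel α v = 0 :=
  kernel_of_notMem fun h' => absurd h'.2 h.not_gt

lemma rpow_two_div_le (hα₀ : 0 < α) (hα₁ : α < 1) {v : ℝ} (h : v ∈ Ioo (0 : ℝ) 1) :
    v ^ (2 / α) ≤ v := by
  have : (1 : ℝ) ≤ 2 / α := by rw [le_div_iff₀ hα₀]; linarith
  simpa using Real.rpow_le_rpow_of_exponent_ge h.1 h.2.le this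

lemma kernel_pos (hα₀ : 0 < α) (hα₁ : α < 1) {v : ℝ} (h : v ∈ Ioo (0 : ℝ) 1) :
    0 < kernel α v := by
  rw [kernel_of_mem h]
  have := rpow_two_div_le hα₀ hα₁ h
  have := gamma_one_sub_pos hα₁
  have h2 : 0 < 1 - v ^ (2 / α) := by linarith [h.2]
  positivity

lemma kernel_nonneg (hα₀ : 0 < α) (hα₁ : α < 1) (v : ℝ) : 0 ≤ kernel α v := by
  by_cases h : v ∈ Ioo (0 : ℝ) 1
  · exact (kernel_pos hα₀ hα₁ h).le
  · rw [kernel_of_notMem h]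

/-- Since `2/α ≥ 1`, the singularity at `1` is no worse than that of `(1 - v)^(-α)`, which is
integrable because `α < 1`. -/
lemma kernel_le (hα₀ : 0 < α) (hα₁ : α < 1) {v : ℝ} (h : v ∈ Ioo (0 : ℝ) 1) :
    kernel α v ≤ 1 / Real.Gamma (1 - α) * (1 - v) ^ (-α) := by
  rw [kernel_of_mem h]
  have := gamma_one_sub_pos hα₁
  have h1 := rpow_two_div_le hα₀ hα₁ h
  gcongr ?_ * ?_
  exact Real.rpow_le_rpow_of_nonpos (by linarith [h.2]) (by linarith) (by linarith)

@[fun_prop]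
lemma measurable_kernel : Measurable (kernel α) := by
  unfold kernel
  exact Measurable.indicator (by fun_prop) measurableSet_Ioo

lemma continuousAt_kernel (hα₀ : 0 < α) (hα₁ : α < 1) {v : ℝ} (h : v ∈ Ioo (0 : ℝ) 1) :
    ContinuousAt (kernel α) v := by
  have h1 := rpow_two_div_le hα₀ hα₁ h
  have : ContinuousAt (fun v : ℝ => 1 / Real.Gamma (1 - α) * (1 - v ^ (2 / α)) ^ (-α)) v := by
    refine continuousAt_const.mul (ContinuousAt.rpow_const ?_ (Or.inl (by linarith [h.2])))
    exact continuousAt_const.sub (continuousAt_id.rpow_const (Or.inl h.1.ne'))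
  refine this.congr ?_
  filter_upwards [isOpen_Ioo.mem_nhds h] with w hw
  rw [kernel_of_mem hw]

lemma integrable_kernel (hα₀ : 0 < α) (hα₁ : α < 1) : Integrable (kernel α) := by
  have h0 : IntervalIntegrable (fun v : ℝ => (1 - v) ^ (-α)) volume 0 1 := by
    have := (intervalIntegral.intervalIntegrable_rpow' (a := 0) (b := 1) (r := -α)
      (by linarith)).comp_sub_left 1
    simpa using this.symm
  have h1 : IntegrableOn (fun v : ℝ => 1 / Real.Gamma (1 - α) * (1 - v) ^ (-α)) (Ioo 0 1) := by
    rw [← integrableOn_Ioc_iff_integrableOn_Ioo, ← intervalIntegrable_iff_integrableOn_Ioc_of_le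
      zero_le_one]
    exact h0.const_mul _
  have h2 : IntegrableOn (kernel α) (Ioo 0 1) := by
    refine Integrable.mono' h1 measurable_kernel.aestronglyMeasurable ?_
    filter_upwards [ae_restrict_mem measurableSet_Ioo] with v hv
    rw [Real.norm_of_nonneg (kernel_nonneg hα₀ hα₁ v)]
    exact kernel_le hα₀ hα₁ hv
  have h3 := (integrable_indicator_iff (μ := volume) measurableSet_Ioo).2 h2
  refine h3.congr (Eventually.of_forall fun v => ?_)
  by_cases hv : v ∈ Ioo (0 : ℝ) 1
  · simp [indicator_of_mem hv]
  · simp [indicator_of_notMem hv, kernel_of_notMem hv]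

lemma continuous_kernelInt (hα₀ : 0 < α) (hα₁ : α < 1) : Continuous (kernelInt α) := by
  have h := (intervalIntegral.continuous_primitive
    (fun a b => (integrable_kernel hα₀ hα₁).intervalIntegrable (a := a) (b := b)) 1).neg
  refine h.congr fun v => ?_
  rw [kernelInt, intervalIntegral.integral_symm, Pi.neg_apply]

lemma kernelInt_of_one_le {v : ℝ} (h : 1 ≤ v) : kernelInt α v = 0 := by
  rw [kernelInt]
  refine intervalIntegral.integral_zero_ae (Eventually.of_forall fun _ hw => ?_)
  rw [uIoc_of_ge h] at hw
  exact kernel_of_one_le hw.1.le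

lemma kernelInt_pos (hα₀ : 0 < α) (hα₁ : α < 1) {v : ℝ} (h : v ∈ Ico (0 : ℝ) 1) :
    0 < kernelInt α v :=
  intervalIntegral.intervalIntegral_pos_of_pos_on (integrable_kernel hα₀ hα₁).intervalIntegrable
    (fun _ hw => kernel_pos hα₀ hα₁ ⟨h.1.trans_lt hw.1, hw.2⟩) h.2

lemma kernelInt_antitone (hα₀ : 0 < α) (hα₁ : α < 1) : Antitone (kernelInt α) := by
  intro a b hab
  have hi (a b : ℝ) := (integrable_kernel hα₀ hα₁).intervalIntegrable (a := a) (b := b)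
  have := intervalIntegral.integral_add_adjacent_intervals (hi a b) (hi b 1)
  have h2 : 0 ≤ ∫ w in a..b, kernel α w :=
    intervalIntegral.integral_nonneg hab fun _ _ => kernel_nonneg hα₀ hα₁ _
  unfold kernelInt
  linarith

lemma kernelInt_nonneg (hα₀ : 0 < α) (hα₁ : α < 1) (v : ℝ) : 0 ≤ kernelInt α v := by
  rcases le_total v 1 with h | h
  · simpa [kernelInt_of_one_le le_rfl] using kernelInt_antitone hα₀ hα₁ h
  · rw [kernelInt_of_one_le h]

lemma kernelInt_le (hα₀ : 0 < α) (hα₁ : α < 1) (v : ℝ) : kernelInt α v ≤ kernelInt α 0 := by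
  rcases le_total 0 v with h | h
  · exact kernelInt_antitone hα₀ hα₁ h
  · have hi (a b : ℝ) := (integrable_kernel hα₀ hα₁).intervalIntegrable (a := a) (b := b)
    have := intervalIntegral.integral_add_adjacent_intervals (hi v 0) (hi 0 1)
    have h2 : ∫ w in v..0, kernel α w = 0 := by
      refine intervalIntegral.integral_zero_ae (Eventually.of_forall fun _ hw => ?_)
      rw [uIoc_of_le h] at hw
      exact kernel_of_notMem fun h' => absurd h'.1 hw.2.not_gt
    unfold kernelInt
    linarith

/-! ### The extended first kernel -/

lemma E₁_nonneg (hα₀ : 0 < α) (hα₁ : α < 1) (p y : ℝ) : 0 ≤ E₁ α p y :=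
  mul_nonneg (le_max_right _ _) (kernelInt_nonneg hα₀ hα₁ _)

lemma E₁_le (hα₀ : 0 < α) (hα₁ : α < 1) (p y : ℝ) : E₁ α p y ≤ max p 0 * kernelInt α 0 :=
  mul_le_mul_of_nonneg_left (kernelInt_le hα₀ hα₁ _) (le_max_right _ _)

lemma E₁_of_le {p y : ℝ} (h : p ≤ y) : E₁ α p y = 0 := by
  rcases le_or_gt p 0 with hp | hp
  · simp [E₁, max_eq_right hp]
  · rw [E₁, max_eq_left hp.le, kernelInt_of_one_le ((one_le_div hp).2 h), mul_zero]

lemma E₁_pos (hα₀ : 0 < α) (hα₁ : α < 1) {p y : ℝ} (hy : 0 ≤ y) (h : y < p) : 0 < E₁ α p y := by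
  have hp := hy.trans_lt h
  rw [E₁, max_eq_left hp.le]
  exact mul_pos hp (kernelInt_pos hα₀ hα₁ ⟨by positivity, (div_lt_one hp).2 h⟩)

lemma continuous_E₁ (hα₀ : 0 < α) (hα₁ : α < 1) :
    Continuous fun q : ℝ × ℝ => E₁ α q.1 q.2 := by
  rw [continuous_iff_continuousAt]
  rintro ⟨p, y⟩
  rcases le_or_gt p 0 with hp | hp
  · have h0 : E₁ α p y = 0 := by simp [E₁, max_eq_right hp]
    rw [ContinuousAt, h0]
    -- For `p ≤ 0` the quotient `y / max p 0` is a division by zero; continuity comes from the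
    -- factor `max p 0` multiplying a bounded function.
    refine squeeze_zero (fun q => E₁_nonneg hα₀ hα₁ q.1 q.2) (fun q => E₁_le hα₀ hα₁ q.1 q.2) ?_
    have : Continuous fun q : ℝ × ℝ => max q.1 0 * kernelInt α 0 := by fun_prop
    simpa [max_eq_right hp] using this.tendsto (p, y)
  · unfold E₁
    have hm : ContinuousAt (fun q : ℝ × ℝ => max q.1 0) (p, y) := by fun_prop
    refine hm.mul ((continuous_kernelInt hα₀ hα₁).continuousAt.comp
      (ContinuousAt.div continuousAt_snd hm ?_))
    simp [max_eq_left hp.le, hp.ne']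

lemma E₁_eq_integral {p : ℝ} (hp : 0 < p) (z : ℝ) :
    E₁ α p z = ∫ w in z..p, kernel α (w / p) := by
  rw [intervalIntegral.integral_comp_div (f := kernel α) hp.ne', E₁, max_eq_left hp.le,
    div_self hp.ne', kernelInt, smul_eq_mul]

lemma kernel_div {p μ : ℝ} (hμ : 0 < μ) (h : μ < p) :
    kernel α (μ / p) = 1 / Real.Gamma (1 - α) * (1 - p ^ (-(2 / α)) * μ ^ (2 / α)) ^ (-α) := by
  have hp := hμ.trans h
  rw [kernel_of_mem ⟨by positivity, (div_lt_one hp).2 h⟩, Real.div_rpow hμ.le hp.le,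
    Real.rpow_neg hp.le, div_eq_inv_mul (μ ^ (2 / α))]

lemma M₁_eq {p y : ℝ} (hy : 0 ≤ y) (h : y ≤ p) : M₁ α p y = E₁ α p y := by
  rcases h.eq_or_lt with rfl | h
  · simp [M₁, E₁_of_le]
  · rw [E₁_eq_integral (hy.trans_lt h), M₁, ← intervalIntegral.integral_const_mul]
    refine intervalIntegral.integral_congr_uIoo fun μ hμ => ?_
    rw [uIoo_of_le h.le] at hμ
    rw [kernel_div (hy.trans_lt hμ.1) hμ.2]

lemma G_eq {c y : ℝ} (hy : 0 ≤ y) (h : y ≤ c) : G α c y = E₁ α c y := M₁_eq hy h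

/-! ### The iterated kernels and the resolvent -/

/-- Continuous extensions of the iterated kernels `M (n + 1)` to the plane. -/
def E (α : ℝ) : ℕ → ℝ → ℝ → ℝ
  | 0, p, y => E₁ α p y
  | n + 1, p, y => ∫ a in y..p, E₁ α a y * E α n p a

/-- A continuous extension of `N` to the plane. -/
def resolvent (α p y : ℝ) : ℝ := ∑' n, E α n p y

lemma E_of_le {p y : ℝ} (h : p ≤ y) : ∀ n, E α n p y = 0
  | 0 => E₁_of_le h
  | n + 1 => by
    refine intervalIntegral.integral_zero_ae (Eventually.of_forall fun a ha => ?_)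
    rw [uIoc_of_ge h] at ha
    rw [E₁_of_le ha.2, zero_mul]

lemma resolvent_of_le {p y : ℝ} (h : p ≤ y) : resolvent α p y = 0 := by
  simp [resolvent, E_of_le h]

lemma continuous_E (hα₀ : 0 < α) (hα₁ : α < 1) :
    ∀ n, Continuous fun q : ℝ × ℝ => E α n q.1 q.2
  | 0 => continuous_E₁ hα₀ hα₁
  | n + 1 => by
    have h1 := continuous_E₁ hα₀ hα₁
    have h2 := continuous_E hα₀ hα₁ n
    have h3 : Continuous (Function.uncurry
        fun (q : ℝ × ℝ) (a : ℝ) => E₁ α a q.2 * E α n q.1 a) :=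
      (h1.comp (by fun_prop : Continuous fun r : (ℝ × ℝ) × ℝ => (r.2, r.1.2))).mul
        (h2.comp (by fun_prop : Continuous fun r : (ℝ × ℝ) × ℝ => (r.1.1, r.2)))
    have h4 := (intervalIntegral.continuous_parametric_intervalIntegral_of_continuous (μ := volume)
      (a₀ := 0) h3 continuous_fst).sub
      (intervalIntegral.continuous_parametric_intervalIntegral_of_continuous (μ := volume)
        (a₀ := 0) h3 continuous_snd)
    refine h4.congr fun q => ?_
    have hc : Continuous fun a => E₁ α a q.2 * E α n q.1 a :=
      h3.comp (by fun_prop : Continuous fun a : ℝ => (q, a))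
    exact intervalIntegral.integral_interval_sub_left (hc.intervalIntegrable _ _)
      (hc.intervalIntegrable _ _)

lemma continuous_E_left (hα₀ : 0 < α) (hα₁ : α < 1) (n : ℕ) (y : ℝ) :
    Continuous fun p => E α n p y :=
  (continuous_E hα₀ hα₁ n).comp (by fun_prop : Continuous fun p : ℝ => (p, y))

lemma continuous_E_right (hα₀ : 0 < α) (hα₁ : α < 1) (n : ℕ) (p : ℝ) :
    Continuous fun y => E α n p y :=
  (continuous_E hα₀ hα₁ n).comp (by fun_prop : Continuous fun y : ℝ => (p, y))

lemma E_nonneg (hα₀ : 0 < α) (hα₁ : α < 1) : ∀ n p y, 0 ≤ E α n p y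
  | 0, p, y => E₁_nonneg hα₀ hα₁ p y
  | n + 1, p, y => by
    rcases le_total y p with h | h
    · exact intervalIntegral.integral_nonneg h fun a _ =>
        mul_nonneg (E₁_nonneg hα₀ hα₁ a y) (E_nonneg hα₀ hα₁ n p a)
    · rw [E_of_le h]

lemma E_pos (hα₀ : 0 < α) (hα₁ : α < 1) {p : ℝ} : ∀ n {y : ℝ}, 0 ≤ y → y < p → 0 < E α n p y
  | 0, _, hy, h => E₁_pos hα₀ hα₁ hy h
  | n + 1, y, hy, h => by
    refine intervalIntegral.intervalIntegral_pos_of_pos_on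
      (((continuous_E_left hα₀ hα₁ 0 y).mul
        (continuous_E_right hα₀ hα₁ n p)).intervalIntegrable _ _) (fun a ha => ?_) h
    exact mul_pos (E₁_pos hα₀ hα₁ hy ha.1) (E_pos hα₀ hα₁ n (hy.trans ha.1.le) ha.2)

/-- The usual Volterra bound: each iteration costs a constant factor and one integration of a power
of `p - a`, which produces the factorial. -/
lemma E_le (hα₀ : 0 < α) (hα₁ : α < 1) (p : ℝ) : ∀ n {y : ℝ}, y ≤ p →
    E α n p y ≤ (kernelInt α 0 * max p 0) ^ (n + 1) * (p - y) ^ n / n.factorial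
  | 0, y, _ => by
    simpa [mul_comm, E] using E₁_le hα₀ hα₁ p y
  | n + 1, y, h => by
    set C := kernelInt α 0 * max p 0 with hC
    have hC0 : 0 ≤ C := mul_nonneg (kernelInt_nonneg hα₀ hα₁ 0) (le_max_right _ _)
    have hb : ∀ a ∈ Icc y p, E₁ α a y * E α n p a ≤
        C * (C ^ (n + 1) * (p - a) ^ n / n.factorial) := by
      intro a ha
      refine mul_le_mul ((E₁_le hα₀ hα₁ a y).trans ?_) (E_le hα₀ hα₁ p n ha.2)
        (E_nonneg hα₀ hα₁ n p a) hC0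
      rw [hC, mul_comm]
      exact mul_le_mul_of_nonneg_left (max_le_max_right 0 ha.2) (kernelInt_nonneg hα₀ hα₁ 0)
    refine (intervalIntegral.integral_mono_on h
      (((continuous_E_left hα₀ hα₁ 0 y).mul
        (continuous_E_right hα₀ hα₁ n p)).intervalIntegrable _ _)
      (Continuous.intervalIntegrable (by fun_prop) _ _) hb).trans_eq ?_
    have hi : ∫ a in y..p, (p - a) ^ n = (p - y) ^ (n + 1) / (n + 1) := by
      rw [intervalIntegral.integral_comp_sub_left (fun x => x ^ n), sub_self, integral_pow]
      simp
    rw [intervalIntegral.integral_const_mul, intervalIntegral.integral_div,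
      intervalIntegral.integral_const_mul, hi, Nat.factorial_succ]
    push_cast
    field_simp
    ring

/-- A summable bound for the iterated kernels on the square `|p| ≤ R`, `|y| ≤ R`. -/
def majorant (α R : ℝ) (n : ℕ) : ℝ :=
  (kernelInt α 0 * R) ^ (n + 1) * (2 * R) ^ n / n.factorial

lemma summable_majorant (α R : ℝ) : Summable (majorant α R) := by
  refine ((Real.summable_pow_div_factorial (kernelInt α 0 * R * (2 * R))).mul_left
    (kernelInt α 0 * R)).congr fun n => ?_
  rw [majorant, mul_pow (kernelInt α 0 * R) (2 * R)]
  ring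

lemma norm_E_le (hα₀ : 0 < α) (hα₁ : α < 1) {R p y : ℝ} (hp : |p| ≤ R) (hy : |y| ≤ R) (n : ℕ) :
    ‖E α n p y‖ ≤ majorant α R n := by
  rw [Real.norm_of_nonneg (E_nonneg hα₀ hα₁ n p y)]
  have hR : 0 ≤ R := (abs_nonneg p).trans hp
  have hk := kernelInt_nonneg hα₀ hα₁ (0 : ℝ)
  rcases le_total y p with h | h
  · refine (E_le hα₀ hα₁ p n h).trans ?_
    rw [majorant]
    have h1 : max p 0 ≤ R := max_le ((le_abs_self p).trans hp) hR
    have h2 : p - y ≤ 2 * R := by linarith [le_abs_self p, neg_abs_le y]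
    have h3 : 0 ≤ p - y := sub_nonneg.2 h
    have h4 : 0 ≤ max p 0 := le_max_right _ _
    gcongr
  · rw [E_of_le h, majorant]
    positivity

lemma summable_E (hα₀ : 0 < α) (hα₁ : α < 1) (p y : ℝ) : Summable fun n => E α n p y :=
  Summable.of_norm_bounded (summable_majorant α (max |p| |y|))
    fun n => norm_E_le hα₀ hα₁ (le_max_left _ _) (le_max_right _ _) n

lemma continuous_resolvent (hα₀ : 0 < α) (hα₁ : α < 1) :
    Continuous fun q : ℝ × ℝ => resolvent α q.1 q.2 := by
  rw [continuous_iff_continuousAt]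
  intro q
  have h : ContinuousOn (fun q : ℝ × ℝ => resolvent α q.1 q.2) (Metric.ball 0 (‖q‖ + 1)) :=
    continuousOn_tsum (fun n => (continuous_E hα₀ hα₁ n).continuousOn)
      (summable_majorant α (‖q‖ + 1)) fun n r hr => by
        rw [mem_ball_zero_iff] at hr
        exact norm_E_le hα₀ hα₁ ((norm_fst_le r).trans hr.le) ((norm_snd_le r).trans hr.le) n
  exact h.continuousAt (Metric.isOpen_ball.mem_nhds (by simp))

lemma continuous_resolvent_left (hα₀ : 0 < α) (hα₁ : α < 1) (y : ℝ) :
    Continuous fun p => resolvent α p y :=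
  (continuous_resolvent hα₀ hα₁).comp (by fun_prop : Continuous fun p : ℝ => (p, y))

lemma continuous_resolvent_right (hα₀ : 0 < α) (hα₁ : α < 1) (p : ℝ) :
    Continuous fun y => resolvent α p y :=
  (continuous_resolvent hα₀ hα₁).comp (by fun_prop : Continuous fun y : ℝ => (p, y))

lemma resolvent_nonneg (hα₀ : 0 < α) (hα₁ : α < 1) (p y : ℝ) : 0 ≤ resolvent α p y :=
  tsum_nonneg fun n => E_nonneg hα₀ hα₁ n p y

lemma E₁_le_resolvent (hα₀ : 0 < α) (hα₁ : α < 1) (p y : ℝ) : E₁ α p y ≤ resolvent α p y :=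
  (summable_E hα₀ hα₁ p y).le_tsum 0 fun n _ => E_nonneg hα₀ hα₁ n p y

lemma resolvent_pos (hα₀ : 0 < α) (hα₁ : α < 1) {p y : ℝ} (hy : 0 ≤ y) (h : y < p) :
    0 < resolvent α p y :=
  (E₁_pos hα₀ hα₁ hy h).trans_le (E₁_le_resolvent hα₀ hα₁ p y)

/-- The iterated kernels are built by adding a factor at the lower variable. Fubini shows that
adding it at the upper variable gives the same kernels; both orders can be written over the full
square because the kernels vanish below the diagonal. -/
lemma E_succ_eq_right (hα₀ : 0 < α) (hα₁ : α < 1) (p : ℝ) : ∀ n {y : ℝ}, y ≤ p →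
    E α (n + 1) p y = ∫ b in y..p, E α n b y * E₁ α p b
  | 0, y, _ => rfl
  | n + 1, y, h => by
    have hE := continuous_E hα₀ hα₁ n
    have hE₁ := continuous_E hα₀ hα₁ 0
    have hc : Continuous (Function.uncurry fun a b => E₁ α a y * (E α n b a * E₁ α p b)) :=
      (hE₁.comp (by fun_prop : Continuous fun r : ℝ × ℝ => (r.1, y))).mul
        ((hE.comp (by fun_prop : Continuous fun r : ℝ × ℝ => (r.2, r.1))).mul
          (hE₁.comp (by fun_prop : Continuous fun r : ℝ × ℝ => (p, r.2))))
    have hcb (a) : Continuous fun b => E α n b a * E₁ α p b :=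
      (continuous_E_left hα₀ hα₁ n a).mul (continuous_E_right hα₀ hα₁ 0 p)
    have hca (b) : Continuous fun a => E₁ α a y * E α n b a :=
      (continuous_E_left hα₀ hα₁ 0 y).mul (continuous_E_right hα₀ hα₁ n b)
    calc E α (n + 1 + 1) p y = ∫ a in y..p, E₁ α a y * E α (n + 1) p a := rfl
      _ = ∫ a in y..p, ∫ b in y..p, E₁ α a y * (E α n b a * E₁ α p b) := by
        refine intervalIntegral.integral_congr fun a ha => ?_
        rw [uIcc_of_le h] at ha
        simp only [intervalIntegral.integral_const_mul]
        rw [E_succ_eq_right hα₀ hα₁ p n ha.2, ← intervalIntegral.integral_add_adjacent_intervals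
          ((hcb a).intervalIntegrable y a) ((hcb a).intervalIntegrable a p)]
        rw [intervalIntegral.integral_zero_ae (a := y), zero_add]
        refine Eventually.of_forall fun b hb => ?_
        rw [uIoc_of_le ha.1] at hb
        rw [E_of_le hb.2, zero_mul]
      _ = ∫ b in y..p, ∫ a in y..p, E₁ α a y * (E α n b a * E₁ α p b) :=
        intervalIntegral_intervalIntegral_swap
          ((hc.continuousOn.integrableOn_compact (isCompact_uIcc.prod isCompact_uIcc)).mono_set
            (prod_mono uIoc_subset_uIcc uIoc_subset_uIcc))
      _ = ∫ b in y..p, E α (n + 1) b y * E₁ α p b := by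
        refine intervalIntegral.integral_congr fun b hb => ?_
        rw [uIcc_of_le h] at hb
        simp only [← mul_assoc, intervalIntegral.integral_mul_const]
        rw [← intervalIntegral.integral_add_adjacent_intervals
          ((hca b).intervalIntegrable y b) ((hca b).intervalIntegrable b p)]
        rw [intervalIntegral.integral_zero_ae (a := b), add_zero]
        · rfl
        refine Eventually.of_forall fun a ha => ?_
        rw [uIoc_of_le hb.2] at ha
        rw [E_of_le ha.1.le, mul_zero]

lemma abs_le_max_of_mem_uIcc {a p y : ℝ} (h : a ∈ uIcc y p) : |a| ≤ max |p| |y| := by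
  rcases mem_uIcc.1 h with h | h
  · rw [max_comm]
    exact abs_le_max_abs_abs h.1 h.2
  · exact abs_le_max_abs_abs h.1 h.2

lemma hasSum_intervalIntegral_of_majorant {F : ℕ → ℝ → ℝ} {f : ℝ → ℝ} {u : ℕ → ℝ} {a b : ℝ}
    (hF : ∀ n, Continuous (F n)) (hu : Summable u) (hb : ∀ n, ∀ t ∈ uIcc a b, ‖F n t‖ ≤ u n)
    (hf : ∀ t, HasSum (fun n => F n t) (f t)) :
    HasSum (fun n => ∫ t in a..b, F n t) (∫ t in a..b, f t) :=
  intervalIntegral.hasSum_integral_of_dominated_convergence (fun n _ => u n)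
    (fun n => (hF n).aestronglyMeasurable)
    (fun n => Eventually.of_forall fun t ht => hb n t (uIoc_subset_uIcc ht))
    (Eventually.of_forall fun _ _ => hu) intervalIntegrable_const
    (Eventually.of_forall fun t _ => hf t)

lemma resolvent_eq_of_hasSum (hα₀ : 0 < α) (hα₁ : α < 1) {p y I : ℝ}
    (h : HasSum (fun n => E α (n + 1) p y) I) : resolvent α p y = E₁ α p y + I := by
  rw [resolvent, (summable_E hα₀ hα₁ p y).tsum_eq_zero_add, h.tsum_eq]
  rfl

/-- As an equation in `y` for fixed `p`, this is the integrated form of the equation for the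
profile. -/
lemma resolvent_eq_left (hα₀ : 0 < α) (hα₁ : α < 1) (p y : ℝ) :
    resolvent α p y = E₁ α p y + ∫ a in y..p, E₁ α a y * resolvent α p a := by
  refine resolvent_eq_of_hasSum hα₀ hα₁ (hasSum_intervalIntegral_of_majorant
    (F := fun n a => E₁ α a y * E α n p a)
    (u := fun n => majorant α (max |p| |y|) 0 * majorant α (max |p| |y|) n)
    (fun n => (continuous_E_left hα₀ hα₁ 0 y).mul (continuous_E_right hα₀ hα₁ n p))
    ((summable_majorant _ _).mul_left _) (fun n a ha => ?_)
    fun a => (summable_E hα₀ hα₁ p a).hasSum.mul_left _)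
  have ha' : |a| ≤ max |p| |y| := abs_le_max_of_mem_uIcc ha
  rw [norm_mul]
  exact mul_le_mul (norm_E_le hα₀ hα₁ ha' (le_max_right _ _) 0)
    (norm_E_le hα₀ hα₁ (le_max_left _ _) ha' n) (norm_nonneg _)
    ((norm_nonneg _).trans (norm_E_le hα₀ hα₁ ha' (le_max_right _ _) 0))

/-- Here the free term `E₁ α p ·` is integrated against the resolvent. With `p = c` this is what
brings in `G_c` and, after another integration, `H`. -/
lemma resolvent_eq_right (hα₀ : 0 < α) (hα₁ : α < 1) {p y : ℝ} (h : y ≤ p) :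
    resolvent α p y = E₁ α p y + ∫ b in y..p, resolvent α b y * E₁ α p b := by
  refine resolvent_eq_of_hasSum hα₀ hα₁ ?_
  simp only [fun n => E_succ_eq_right hα₀ hα₁ p n h]
  refine hasSum_intervalIntegral_of_majorant
    (F := fun n b => E α n b y * E₁ α p b)
    (u := fun n => majorant α (max |p| |y|) n * majorant α (max |p| |y|) 0)
    (fun n => (continuous_E_left hα₀ hα₁ n y).mul (continuous_E_right hα₀ hα₁ 0 p))
    ((summable_majorant _ _).mul_right _) (fun n a ha => ?_)
    fun b => (summable_E hα₀ hα₁ b y).hasSum.mul_right _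
  have ha' : |a| ≤ max |p| |y| := abs_le_max_of_mem_uIcc ha
  rw [norm_mul]
  exact mul_le_mul (norm_E_le hα₀ hα₁ ha' (le_max_right _ _) n)
    (norm_E_le hα₀ hα₁ (le_max_left _ _) ha' 0) (norm_nonneg _)
    ((norm_nonneg _).trans (norm_E_le hα₀ hα₁ ha' (le_max_right _ _) n))

/-! ### Identification with the kernels of the statement -/

lemma M_succ_eq {p : ℝ} : ∀ n {y : ℝ}, 0 ≤ y → y ≤ p → M α (n + 1) p y = E α n p y
  | 0, _, hy, h => M₁_eq hy h
  | n + 1, y, hy, h => by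
    rw [M, E]
    refine intervalIntegral.integral_congr fun a ha => ?_
    rw [uIcc_of_le h] at ha
    rw [M₁_eq hy ha.1, M_succ_eq n (hy.trans ha.1) ha.2]

lemma N_eq {p y : ℝ} (hy : 0 ≤ y) (h : y ≤ p) : N α p y = resolvent α p y := by
  simp only [N, resolvent, M_succ_eq _ hy h]

lemma tendstoUniformlyOn_N (hα₀ : 0 < α) (hα₁ : α < 1) (R : ℝ) :
    TendstoUniformlyOn (fun (k : ℕ) (q : ℝ × ℝ) => ∑ n ∈ Finset.Icc 1 k, M α n q.1 q.2)
      (fun q : ℝ × ℝ => N α q.1 q.2) atTop {q : ℝ × ℝ | 0 ≤ q.2 ∧ q.2 ≤ q.1 ∧ q.1 ≤ R} := by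
  have h := tendstoUniformlyOn_tsum_nat (f := fun n (q : ℝ × ℝ) => E α n q.1 q.2)
    (s := {q : ℝ × ℝ | 0 ≤ q.2 ∧ q.2 ≤ q.1 ∧ q.1 ≤ R}) (summable_majorant α R)
    fun n q hq => by
      obtain ⟨h1, h2, h3⟩ := hq
      exact norm_E_le hα₀ hα₁ (by rwa [abs_of_nonneg (h1.trans h2)])
        (by rw [abs_of_nonneg h1]; exact h2.trans h3) n
  refine (h.congr (Eventually.of_forall fun k q hq => ?_)).congr_right fun q hq => ?_
  · simp only
    -- `M` is numbered from `1` and `E` from `0`, so the partial sums are shifted by one.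
    rw [← Finset.Ico_add_one_right_eq_Icc, Finset.sum_Ico_eq_sum_range]
    refine Finset.sum_congr (by simp) fun n _ => ?_
    rw [add_comm 1 n, M_succ_eq n hq.1 hq.2.1]
  · exact (N_eq hq.1 hq.2.1).symm

lemma kernels_pos (hα₀ : 0 < α) (hα₁ : α < 1) {p y : ℝ} (hy : 0 ≤ y) (h : y < p) :
    (∀ n : ℕ, 1 ≤ n → 0 < M α n p y) ∧ 0 < N α p y := by
  refine ⟨fun n hn => ?_, by rw [N_eq hy h.le]; exact resolvent_pos hα₀ hα₁ hy h⟩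
  obtain ⟨k, rfl⟩ := Nat.exists_eq_add_of_le' hn
  rw [M_succ_eq k hy h.le]
  exact E_pos hα₀ hα₁ k hy h

/-- The function of the self-similar variable in the statement is a primitive of the resolvent. -/
lemma integral_H_mul_G (hα₀ : 0 < α) (hα₁ : α < 1) {c z : ℝ} (hz : 0 ≤ z) (h : z ≤ c) :
    ∫ p in z..c, H α p z * G α c p = ∫ w in z..c, resolvent α c w := by
  have hR := continuous_resolvent hα₀ hα₁
  have hE₁ : Continuous fun y => E₁ α c y := continuous_E_right hα₀ hα₁ 0 c
  have hc : Continuous (Function.uncurry fun w b => resolvent α b w * E₁ α c b) :=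
    (hR.comp (by fun_prop : Continuous fun r : ℝ × ℝ => (r.2, r.1))).mul
      (hE₁.comp continuous_snd)
  have hcw (w) : Continuous fun b => resolvent α b w * E₁ α c b :=
    (continuous_resolvent_left hα₀ hα₁ w).mul hE₁
  have hcb (b) : Continuous fun w => resolvent α b w := continuous_resolvent_right hα₀ hα₁ b
  have hi : Continuous fun w => ∫ b in z..c, resolvent α b w * E₁ α c b :=
    intervalIntegral.continuous_parametric_intervalIntegral_of_continuous hc continuous_const
  have hi' : Continuous fun b => ∫ w in z..c, resolvent α b w * E₁ α c b :=
    intervalIntegral.continuous_parametric_intervalIntegral_of_continuous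
      (f := fun b w => resolvent α b w * E₁ α c b) (hc.comp continuous_swap) continuous_const
  symm
  calc ∫ w in z..c, resolvent α c w
      = ∫ w in z..c, (E₁ α c w + ∫ b in z..c, resolvent α b w * E₁ α c b) := by
        refine intervalIntegral.integral_congr fun w hw => ?_
        rw [uIcc_of_le h] at hw
        rw [resolvent_eq_right hα₀ hα₁ hw.2, ← intervalIntegral.integral_add_adjacent_intervals
          ((hcw w).intervalIntegrable z w) ((hcw w).intervalIntegrable w c),
          intervalIntegral.integral_zero_ae (a := z), zero_add]
        refine Eventually.of_forall fun b hb => ?_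
        rw [uIoc_of_le hw.1] at hb
        rw [resolvent_of_le hb.2, zero_mul]
    _ = (∫ w in z..c, E₁ α c w) + ∫ b in z..c, ∫ w in z..c, resolvent α b w * E₁ α c b := by
        rw [intervalIntegral.integral_add (hE₁.intervalIntegrable _ _) (hi.intervalIntegrable _ _),
          intervalIntegral_intervalIntegral_swap
          ((hc.continuousOn.integrableOn_compact (isCompact_uIcc.prod isCompact_uIcc)).mono_set
            (prod_mono uIoc_subset_uIcc uIoc_subset_uIcc))]
    _ = ∫ b in z..c, (E₁ α c b + ∫ w in z..c, resolvent α b w * E₁ α c b) :=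
        (intervalIntegral.integral_add (hE₁.intervalIntegrable _ _)
          (hi'.intervalIntegrable _ _)).symm
    _ = ∫ p in z..c, H α p z * G α c p := by
        refine intervalIntegral.integral_congr fun b hb => ?_
        rw [uIcc_of_le h] at hb
        have h1 : ∫ y in z..b, N α b y = ∫ y in z..b, resolvent α b y := by
          refine intervalIntegral.integral_congr fun y hy => ?_
          rw [uIcc_of_le hb.1] at hy
          exact N_eq (hz.trans hy.1) hy.2
        simp only [intervalIntegral.integral_mul_const]
        rw [H, h1, G_eq (hz.trans hb.1) hb.2, ← intervalIntegral.integral_add_adjacent_intervals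
          ((hcb b).intervalIntegrable z b) ((hcb b).intervalIntegrable b c),
          intervalIntegral.integral_zero_ae (a := b)]
        · ring
        refine Eventually.of_forall fun w hw => ?_
        rw [uIoc_of_le hb.2] at hw
        exact resolvent_of_le hw.1.le

lemma exists_resolvent_eq (hα₀ : 0 < α) (hα₁ : α < 1) {β : ℝ} (hβ : 0 < β) :
    ∃ c, 0 < c ∧ resolvent α c 0 = β := by
  have hk := kernelInt_pos hα₀ hα₁ (v := 0) ⟨le_rfl, one_pos⟩
  have hb : 0 ≤ β / kernelInt α 0 := by positivity
  -- The first term of the series alone is `c * kernelInt α 0` at `y = 0`, which already reaches `β`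
  -- at this endpoint; at `c = 0` the resolvent is zero.
  have h1 : β ≤ resolvent α (β / kernelInt α 0) 0 := by
    refine le_trans ?_ (E₁_le_resolvent hα₀ hα₁ _ _)
    rw [E₁, max_eq_left hb, zero_div]
    field_simp
    exact le_rfl
  obtain ⟨c, hc, h⟩ := intermediate_value_Icc hb
    (continuous_resolvent_left hα₀ hα₁ 0).continuousOn
    ⟨(resolvent_of_le (α := α) (le_refl (0 : ℝ))).trans_le hβ.le, h1⟩
  refine ⟨c, hc.1.lt_of_ne ?_, h⟩
  rintro rfl
  simp only [resolvent_of_le (α := α) (le_refl (0 : ℝ))] at h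
  exact hβ.ne h

/-! ### The memory term and the derivative of the resolvent -/

/-- The memory term `w ↦ ∫_w^c (1 - (w/p)^{2/α})^{-α} N(c,p) dp / Γ(1-α)`. -/
def memory (α c w : ℝ) : ℝ := ∫ p in (0 : ℝ)..c, kernel α (w / p) * resolvent α c p

lemma kernel_div_of_le {w p : ℝ} (hw : 0 ≤ w) (h : p ≤ w) : kernel α (w / p) = 0 := by
  refine kernel_of_notMem fun h' => ?_
  rcases le_or_gt p 0 with hp | hp
  · exact absurd h'.1 (div_nonpos_of_nonneg_of_nonpos hw hp).not_gt
  · exact absurd ((div_lt_one hp).1 h'.2) h.not_gt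

/-- The kernel kills `p ≤ w` and the resolvent kills `p ≥ c`, so limits of integration may be moved
freely outside `(w,c)`. -/
lemma integral_kernel_mul_resolvent {c w a b : ℝ} (hw : 0 ≤ w) (hab : a ≤ b) (ha : a ≤ w)
    (hb : c ≤ b) : ∫ p in a..b, kernel α (w / p) * resolvent α c p =
      ∫ p, kernel α (w / p) * resolvent α c p := by
  rw [intervalIntegral.integral_of_le hab]
  refine setIntegral_eq_integral_of_forall_compl_eq_zero fun p hp => ?_
  rw [mem_Ioc, not_and_or, not_lt, not_le] at hp
  rcases hp with hp | hp
  · rw [kernel_div_of_le hw (hp.trans ha), zero_mul]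
  · rw [resolvent_of_le (hb.trans hp.le), mul_zero]

lemma memory_of_le {c w : ℝ} (hc : 0 < c) (h : c ≤ w) : memory α c w = 0 := by
  refine intervalIntegral.integral_zero_ae (Eventually.of_forall fun p hp => ?_)
  rw [uIoc_of_le hc.le] at hp
  rw [kernel_div_of_le (hc.le.trans h) (hp.2.trans h), zero_mul]

lemma memory_nonneg (hα₀ : 0 < α) (hα₁ : α < 1) {c : ℝ} (hc : 0 < c) (w : ℝ) :
    0 ≤ memory α c w :=
  intervalIntegral.integral_nonneg hc.le fun _ _ =>
    mul_nonneg (kernel_nonneg hα₀ hα₁ _) (resolvent_nonneg hα₀ hα₁ _ _)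

/-- The shift `p = w + q` pins the singularity at `q = 0` for every `w`, which makes a dominating
function independent of `w` possible. -/
lemma memory_eq_shift {c w : ℝ} (hc : 0 < c) (hw : 0 < w) :
    memory α c w = ∫ q in (0 : ℝ)..c, kernel α (w / (w + q)) * resolvent α c (w + q) := by
  rw [intervalIntegral.integral_comp_add_left
    (fun p => kernel α (w / p) * resolvent α c p) w, memory,
    integral_kernel_mul_resolvent hw.le hc.le hw.le le_rfl,
    integral_kernel_mul_resolvent hw.le (by linarith) (by linarith) (by linarith)]

lemma exists_resolvent_bound (hα₀ : 0 < α) (hα₁ : α < 1) (c : ℝ) :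
    ∃ B, 0 ≤ B ∧ ∀ p, 0 ≤ p → resolvent α c p ≤ B := by
  obtain ⟨B, hB⟩ := isCompact_Icc.exists_bound_of_continuousOn (s := Icc 0 c)
    (continuous_resolvent_right hα₀ hα₁ c).continuousOn
  refine ⟨max B 0, le_max_right _ _, fun p hp => ?_⟩
  rcases le_total p c with h | h
  · exact (le_abs_self _).trans ((hB p ⟨hp, h⟩).trans (le_max_left _ _))
  · rw [resolvent_of_le h]
    exact le_max_right _ _

lemma exists_shift_bound (hα₀ : 0 < α) (hα₁ : α < 1) {c : ℝ} (hc : 0 < c) :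
    ∃ B, ∀ w q, 0 < w → 0 < q →
      ‖kernel α (w / (w + q)) * resolvent α c (w + q)‖ ≤ B * q ^ (-α) := by
  obtain ⟨B, hB0, hB⟩ := exists_resolvent_bound hα₀ hα₁ c
  have hΓ := gamma_one_sub_pos hα₁
  refine ⟨1 / Real.Gamma (1 - α) * c ^ α * B, fun w q hw hq => ?_⟩
  have hwq : 0 < w + q := by positivity
  rw [Real.norm_of_nonneg (mul_nonneg (kernel_nonneg hα₀ hα₁ _) (resolvent_nonneg hα₀ hα₁ _ _))]
  rcases le_total c (w + q) with h | h
  · rw [resolvent_of_le h, mul_zero]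
    positivity
  -- Because `1 - w/(w+q) = q/(w+q)`, the singular factor is `(w+q)^α q^(-α)`, and `w + q ≤ c` in
  -- this case.
  have h1 : kernel α (w / (w + q)) ≤ 1 / Real.Gamma (1 - α) * (c ^ α * q ^ (-α)) := by
    refine (kernel_le hα₀ hα₁ ⟨by positivity, (div_lt_one hwq).2 (by linarith)⟩).trans ?_
    have : 1 - w / (w + q) = q / (w + q) := by field_simp; ring
    rw [this, Real.div_rpow hq.le hwq.le, Real.rpow_neg hwq.le, div_inv_eq_mul, mul_comm (q ^ _)]
    gcongr
  calc _ ≤ 1 / Real.Gamma (1 - α) * (c ^ α * q ^ (-α)) * B :=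
        mul_le_mul h1 (hB _ hwq.le) (resolvent_nonneg hα₀ hα₁ _ _) (by positivity)
    _ = _ := by ring

lemma intervalIntegrable_rpow_neg (hα₁ : α < 1) (a b : ℝ) :
    IntervalIntegrable (fun q : ℝ => q ^ (-α)) volume a b :=
  intervalIntegral.intervalIntegrable_rpow' (by linarith)

lemma exists_memory_bound (hα₀ : 0 < α) (hα₁ : α < 1) {c : ℝ} (hc : 0 < c) :
    ∃ B, ∀ w, 0 < w → ‖memory α c w‖ ≤ B := by
  obtain ⟨B, hB⟩ := exists_shift_bound hα₀ hα₁ hc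
  refine ⟨∫ q in (0 : ℝ)..c, B * q ^ (-α), fun w hw => ?_⟩
  rw [memory_eq_shift hc hw]
  exact intervalIntegral.norm_integral_le_of_norm_le hc.le
    (Eventually.of_forall fun q hq => hB w q hw hq.1)
    ((intervalIntegrable_rpow_neg hα₁ _ _).const_mul B)

lemma continuousOn_memory (hα₀ : 0 < α) (hα₁ : α < 1) {c : ℝ} (hc : 0 < c) :
    ContinuousOn (memory α c) (Ioi 0) := by
  obtain ⟨B, hB⟩ := exists_shift_bound hα₀ hα₁ hc
  have hg := continuous_resolvent_right hα₀ hα₁ c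
  have h : ContinuousOn
      (fun w => ∫ q in (0 : ℝ)..c, kernel α (w / (w + q)) * resolvent α c (w + q)) (Ioi 0) := by
    intro w hw
    refine intervalIntegral.continuousWithinAt_of_dominated_interval
      (bound := fun q => B * q ^ (-α)) (Eventually.of_forall fun w => ?_) ?_
      ((intervalIntegrable_rpow_neg hα₁ _ _).const_mul B) (Eventually.of_forall fun q hq => ?_)
    · exact Measurable.aestronglyMeasurable (by
        have := hg.measurable
        fun_prop)
    · filter_upwards [self_mem_nhdsWithin] with w hw
      refine Eventually.of_forall fun q hq => ?_
      rw [uIoc_of_le hc.le] at hq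
      exact hB w q hw hq.1
    · rw [uIoc_of_le hc.le] at hq
      have hw : 0 < w := hw
      have hwq : 0 < w + q := add_pos hw hq.1
      refine ContinuousAt.continuousWithinAt (ContinuousAt.mul ?_ (by fun_prop))
      refine ContinuousAt.comp (f := fun w => w / (w + q)) (continuousAt_kernel hα₀ hα₁
        ⟨by positivity, (div_lt_one hwq).2 (by linarith [hq.1])⟩) ?_
      exact continuousAt_id.div (by fun_prop) hwq.ne'
  exact h.congr fun w hw => memory_eq_shift hc hw

lemma intervalIntegrable_memory (hα₀ : 0 < α) (hα₁ : α < 1) {c : ℝ} (hc : 0 < c) {a b : ℝ}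
    (ha : 0 ≤ a) (hb : 0 ≤ b) : IntervalIntegrable (memory α c) volume a b := by
  obtain ⟨B, hB⟩ := exists_memory_bound hα₀ hα₁ hc
  have hs : uIoc a b ⊆ Ioi 0 := fun x hx => (le_min ha hb).trans_lt hx.1
  rw [intervalIntegrable_iff]
  refine Integrable.mono' (g := fun _ => B)
    (integrableOn_const measure_Ioc_lt_top.ne)
    (((continuousOn_memory hα₀ hα₁ hc).mono hs).aestronglyMeasurable measurableSet_uIoc) ?_
  filter_upwards [ae_restrict_mem measurableSet_uIoc] with w hw
  exact hB w (hs hw)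

/-- Write `E₁ α a z` as the integral of `kernel α (w / a)` over `w` and exchange the integrals.
Everything is nonnegative, so integrability on the square reduces to that of the continuous function
`E₁ α a z * resolvent α c a`. -/
lemma integral_E₁_mul_resolvent (hα₀ : 0 < α) (hα₁ : α < 1) {c z : ℝ} (hz : 0 ≤ z) (h : z ≤ c) :
    ∫ a in z..c, E₁ α a z * resolvent α c a = ∫ w in z..c, memory α c w := by
  have hg := continuous_resolvent_right hα₀ hα₁ c
  have hinner : ∀ a ∈ Ioc z c, ∫ w in z..c, kernel α (w / a) * resolvent α c a =
      E₁ α a z * resolvent α c a := by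
    intro a ha
    have hi (x y : ℝ) : IntervalIntegrable (fun w => kernel α (w / a)) volume x y :=
      ((integrable_kernel hα₀ hα₁).comp_div (hz.trans_lt ha.1).ne').intervalIntegrable
    rw [intervalIntegral.integral_mul_const, E₁_eq_integral (hz.trans_lt ha.1),
      ← intervalIntegral.integral_add_adjacent_intervals (hi z a) (hi a c),
      intervalIntegral.integral_zero_ae (a := a), add_zero]
    refine Eventually.of_forall fun w hw => ?_
    rw [uIoc_of_le ha.2] at hw
    exact kernel_div_of_le ((hz.trans ha.1.le).trans hw.1.le) hw.1.le
  have hint : IntegrableOn (Function.uncurry fun a w => kernel α (w / a) * resolvent α c a)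
      (uIoc z c ×ˢ uIoc z c) := by
    rw [uIoc_of_le h, IntegrableOn, Measure.volume_eq_prod, ← Measure.prod_restrict,
      integrable_prod_iff]
    · constructor
      · filter_upwards [ae_restrict_mem measurableSet_Ioc] with a ha
        exact ((integrable_kernel hα₀ hα₁).comp_div (hz.trans_lt ha.1).ne').restrict.mul_const
          (resolvent α c a)
      · have : IntegrableOn (fun a => E₁ α a z * resolvent α c a) (Ioc z c) :=
          (((continuous_E_left hα₀ hα₁ 0 z).mul hg).integrableOn_Icc).mono_set Ioc_subset_Icc_self
        refine this.congr_fun (fun a ha => ?_) measurableSet_Ioc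
        simp only
        rw [← hinner a ha, intervalIntegral.integral_of_le h]
        refine integral_congr_ae (Eventually.of_forall fun w => ?_)
        simp only [Function.uncurry]
        rw [Real.norm_of_nonneg
          (mul_nonneg (kernel_nonneg hα₀ hα₁ _) (resolvent_nonneg hα₀ hα₁ _ _))]
    · refine Measurable.aestronglyMeasurable ?_
      have := hg.measurable
      unfold Function.uncurry
      fun_prop
  calc ∫ a in z..c, E₁ α a z * resolvent α c a
      = ∫ a in z..c, ∫ w in z..c, kernel α (w / a) * resolvent α c a := by
        refine intervalIntegral.integral_congr_uIoo fun a ha => ?_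
        rw [uIoo_of_le h] at ha
        exact (hinner a ⟨ha.1, ha.2.le⟩).symm
    _ = ∫ w in z..c, ∫ a in z..c, kernel α (w / a) * resolvent α c a :=
        intervalIntegral_intervalIntegral_swap hint
    _ = ∫ w in z..c, memory α c w := by
        refine intervalIntegral.integral_congr fun w hw => ?_
        rw [uIcc_of_le h] at hw
        simp only [memory]
        rw [integral_kernel_mul_resolvent (hz.trans hw.1) (hz.trans h) (hz.trans hw.1) le_rfl,
          integral_kernel_mul_resolvent (hz.trans hw.1) h hw.1 le_rfl]

/-- The only singular part is the explicit `E₁`; the other summand is a primitive of a bounded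
function, continuous on `(0,∞)`. Covering `z ≥ c` as well allows that summand to be differentiated
across the front. -/
lemma resolvent_eq_memory (hα₀ : 0 < α) (hα₁ : α < 1) {c z : ℝ} (hc : 0 < c) (hz : 0 ≤ z) :
    resolvent α c z = E₁ α c z + ∫ w in z..c, memory α c w := by
  rcases le_total z c with h | h
  · rw [resolvent_eq_left hα₀ hα₁, integral_E₁_mul_resolvent hα₀ hα₁ hz h]
  · rw [resolvent_of_le h, E₁_of_le h, intervalIntegral.integral_zero_ae, add_zero]
    refine Eventually.of_forall fun w hw => ?_
    rw [uIoc_of_ge h] at hw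
    exact memory_of_le hc hw.1.le

lemma hasDerivAt_integral_memory (hα₀ : 0 < α) (hα₁ : α < 1) {c z : ℝ} (hc : 0 < c) (hz : 0 < z) :
    HasDerivAt (fun z => ∫ w in z..c, memory α c w) (-memory α c z) z :=
  intervalIntegral.integral_hasDerivAt_left (intervalIntegrable_memory hα₀ hα₁ hc hz.le hc.le)
    ((continuousOn_memory hα₀ hα₁ hc).stronglyMeasurableAtFilter isOpen_Ioi z hz)
    ((continuousOn_memory hα₀ hα₁ hc).continuousAt (Ioi_mem_nhds hz))

lemma hasDerivAt_E₁ (hα₀ : 0 < α) (hα₁ : α < 1) {c z : ℝ} (hz : 0 < z) (h : z < c) :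
    HasDerivAt (fun z => E₁ α c z) (-kernel α (z / c)) z := by
  have hc := hz.trans h
  simp only [E₁_eq_integral hc]
  refine intervalIntegral.integral_hasDerivAt_left (f := fun w => kernel α (w / c))
    ((integrable_kernel hα₀ hα₁).comp_div hc.ne').intervalIntegrable ?_ ?_
  · exact Measurable.stronglyMeasurable (by fun_prop) |>.stronglyMeasurableAtFilter
  · exact ContinuousAt.comp (f := fun w => w / c)
      (continuousAt_kernel hα₀ hα₁ ⟨by positivity, (div_lt_one hc).2 h⟩) (by fun_prop)

/-- The derivative of `-N(c,·)`, i.e. the second derivative of the profile. -/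
def profileDeriv₂ (α c z : ℝ) : ℝ := kernel α (z / c) + memory α c z

lemma profileDeriv₂_nonneg (hα₀ : 0 < α) (hα₁ : α < 1) {c : ℝ} (hc : 0 < c) (z : ℝ) :
    0 ≤ profileDeriv₂ α c z :=
  add_nonneg (kernel_nonneg hα₀ hα₁ _) (memory_nonneg hα₀ hα₁ hc _)

/-- This is the governing equation in the self-similar variable: `kernel α (z / c)` is the source
term and `memory α c z` the Caputo derivative, both up to the factor `t^(-α)`. -/
lemma hasDerivAt_resolvent (hα₀ : 0 < α) (hα₁ : α < 1) {c z : ℝ} (hz : 0 < z) (h : z < c) :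
    HasDerivAt (resolvent α c) (-profileDeriv₂ α c z) z := by
  have hc := hz.trans h
  have := (hasDerivAt_E₁ hα₀ hα₁ hz h).add (hasDerivAt_integral_memory hα₀ hα₁ hc hz)
  rw [profileDeriv₂, neg_add]
  refine this.congr_of_eventuallyEq ?_
  filter_upwards [Ioi_mem_nhds hz] with w hw
  exact resolvent_eq_memory hα₀ hα₁ hc (le_of_lt hw)

/-! ### Beta integrals -/

lemma ofReal_beta_integrand {θ : ℝ} (hθ : θ ∈ Icc (0 : ℝ) 1) :
    ((θ : ℂ) ^ ((1 - α : ℝ) - 1 : ℂ) * (1 - (θ : ℂ)) ^ ((α : ℂ) - 1)) =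
      (((1 - θ) ^ (α - 1) * θ ^ (-α) : ℝ) : ℂ) := by
  have h1 : (1 - (θ : ℂ)) ^ ((α : ℂ) - 1) = (((1 - θ) ^ (α - 1) : ℝ) : ℂ) := by
    rw [Complex.ofReal_cpow (sub_nonneg.2 hθ.2)]
    push_cast
    rfl
  have h2 : (θ : ℂ) ^ ((1 - α : ℝ) - 1 : ℂ) = ((θ ^ (-α) : ℝ) : ℂ) := by
    rw [Complex.ofReal_cpow hθ.1]
    congr 1
    push_cast
    ring
  rw [h1, h2]
  push_cast
  ring

lemma intervalIntegrable_beta (hα₀ : 0 < α) (hα₁ : α < 1) :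
    IntervalIntegrable (fun θ : ℝ => (1 - θ) ^ (α - 1) * θ ^ (-α)) volume 0 1 := by
  have h := Complex.betaIntegral_convergent (u := (1 - α : ℝ)) (v := α)
    (by simpa using hα₁) (by simpa using hα₀)
  refine h.norm.congr fun θ hθ => ?_
  rw [uIoc_of_le zero_le_one] at hθ
  rw [ofReal_beta_integrand ⟨hθ.1.le, hθ.2⟩, Complex.norm_real, Real.norm_of_nonneg]
  have := sub_nonneg.2 hθ.2
  have := hθ.1.le
  positivity

lemma integral_beta (hα₀ : 0 < α) (hα₁ : α < 1) :
    ∫ θ in (0 : ℝ)..1, (1 - θ) ^ (α - 1) * θ ^ (-α) = Real.Gamma α * Real.Gamma (1 - α) := by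
  have h := Complex.Gamma_mul_Gamma_eq_betaIntegral (s := (1 - α : ℝ)) (t := α)
    (by simpa using hα₁) (by simpa using hα₀)
  have h2 : Complex.betaIntegral (1 - α : ℝ) α =
      ((∫ θ in (0 : ℝ)..1, (1 - θ) ^ (α - 1) * θ ^ (-α) : ℝ) : ℂ) := by
    rw [Complex.betaIntegral, ← intervalIntegral.integral_ofReal]
    refine intervalIntegral.integral_congr fun θ hθ => ?_
    rw [uIcc_of_le zero_le_one] at hθ
    exact ofReal_beta_integrand hθ
  rw [h2, Complex.Gamma_ofReal, Complex.Gamma_ofReal] at h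
  have h3 : (((1 - α : ℝ) : ℂ) + α) = 1 := by push_cast; ring
  rw [h3, Complex.Gamma_one, one_mul] at h
  rw [mul_comm (Real.Gamma α)]
  exact_mod_cast h.symm

/-- Under `θ = σ + (1 - σ) v` the powers of `1 - σ` have total exponent `1 + (α - 1) - α = 0`, so
the value does not depend on `σ`. -/
lemma integral_beta_shift (hα₀ : 0 < α) (hα₁ : α < 1) {σ : ℝ} (hσ : σ < 1) :
    ∫ θ in σ..1, (1 - θ) ^ (α - 1) * (θ - σ) ^ (-α) = Real.Gamma α * Real.Gamma (1 - α) := by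
  have h := intervalIntegral.mul_integral_comp_add_mul (a := 0) (b := 1)
    (f := fun θ : ℝ => (1 - θ) ^ (α - 1) * (θ - σ) ^ (-α)) (1 - σ) σ
  have h1 : σ + (1 - σ) * 1 = 1 := by ring
  rw [mul_zero, add_zero, h1] at h
  rw [← h, ← integral_beta hα₀ hα₁, ← intervalIntegral.integral_const_mul]
  refine intervalIntegral.integral_congr fun v hv => ?_
  rw [uIcc_of_le zero_le_one] at hv
  have hs : 0 < 1 - σ := sub_pos.2 hσ
  have e1 : 1 - (σ + (1 - σ) * v) = (1 - σ) * (1 - v) := by ring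
  have e2 : σ + (1 - σ) * v - σ = (1 - σ) * v := by ring
  rw [e1, e2, Real.mul_rpow hs.le (sub_nonneg.2 hv.2), Real.mul_rpow hs.le hv.1,
    Real.rpow_sub hs, Real.rpow_one, Real.rpow_neg hs.le]
  have := (Real.rpow_pos_of_pos hs α).ne'
  field_simp

/-! ### The profile of the fractional flux -/

/-- The weight in the self-similar form of the flux. -/
def weight (α θ : ℝ) : ℝ := (1 - θ) ^ (α - 1) * θ ^ (-(α / 2))

/-- The self-similar profile of the fractional integral of the flux of `φ`. -/
def fluxTransform (α : ℝ) (φ : ℝ → ℝ) (z : ℝ) : ℝ :=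
  ∫ θ in (0 : ℝ)..1, weight α θ * φ (z * θ ^ (-(α / 2)))

lemma rpow_neg_half_mul_self {θ : ℝ} (hθ : 0 < θ) :
    θ ^ (-(α / 2)) * θ ^ (-(α / 2)) = θ ^ (-α) := by
  rw [← Real.rpow_add hθ]
  congr 1
  ring

lemma weight_nonneg {θ : ℝ} (hθ : θ ∈ Ioc (0 : ℝ) 1) : 0 ≤ weight α θ := by
  have := sub_nonneg.2 hθ.2
  have := hθ.1.le
  unfold weight
  positivity

lemma one_le_rpow_neg_half (hα₀ : 0 < α) {θ : ℝ} (hθ : θ ∈ Ioc (0 : ℝ) 1) :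
    1 ≤ θ ^ (-(α / 2)) :=
  Real.one_le_rpow_of_pos_of_le_one_of_nonpos hθ.1 hθ.2 (by linarith)

lemma weight_mul_rpow {θ : ℝ} (hθ : 0 < θ) :
    weight α θ * θ ^ (-(α / 2)) = (1 - θ) ^ (α - 1) * θ ^ (-α) := by
  rw [weight, mul_assoc, rpow_neg_half_mul_self hθ]

@[fun_prop]
lemma measurable_weight : Measurable (weight α) := by
  unfold weight
  fun_prop

lemma intervalIntegrable_fluxTransform (hα₀ : 0 < α) (hα₁ : α < 1) {φ : ℝ → ℝ} {B z : ℝ}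
    (hφ : Measurable φ) (hb : ∀ p, 0 ≤ p → |φ p| ≤ B) (hz : 0 ≤ z) :
    IntervalIntegrable (fun θ => weight α θ * φ (z * θ ^ (-(α / 2)))) volume 0 1 := by
  refine ((intervalIntegrable_beta hα₀ hα₁).mul_const B).mono_fun'
    (Measurable.aestronglyMeasurable (by fun_prop)) ?_
  filter_upwards [ae_restrict_mem measurableSet_uIoc] with θ hθ
  rw [uIoc_of_le zero_le_one] at hθ
  have hw := weight_nonneg (α := α) hθ
  have h1 := one_le_rpow_neg_half hα₀ hθ
  have hB := hb (z * θ ^ (-(α / 2))) (by positivity)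
  -- Inserting a further factor `θ^(-α/2) ≥ 1` turns `weight` into the integrable Beta density.
  rw [norm_mul, Real.norm_of_nonneg hw, ← weight_mul_rpow hθ.1]
  exact mul_le_mul (le_mul_of_one_le_right hw h1) hB (norm_nonneg _) (by positivity)

lemma intervalIntegrable_kernel_div {c : ℝ} (hα₀ : 0 < α) (hα₁ : α < 1) (hc : 0 < c) (a b : ℝ) :
    IntervalIntegrable (fun w => kernel α (w / c)) volume a b :=
  ((integrable_kernel hα₀ hα₁).comp_div hc.ne').intervalIntegrable

/-- The substitution `w = y l` would end at `c / l`; since the kernel vanishes beyond `1`, the upper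
limit can be kept at `c`, independent of `l`, ready for Fubini on a rectangle. -/
lemma E₁_mul_eq (hα₀ : 0 < α) (hα₁ : α < 1) {c l : ℝ} (hc : 0 < c) (hl : 1 ≤ l) (z : ℝ) :
    E₁ α c (z * l) = l * ∫ y in z..c, kernel α (y * l / c) := by
  have h := intervalIntegral.mul_integral_comp_mul_left (a := z) (b := c)
    (f := fun w => kernel α (w / c)) l
  simp only [mul_comm l _] at h ⊢
  rw [h, E₁_eq_integral hc, ← intervalIntegral.integral_add_adjacent_intervals
    (intervalIntegrable_kernel_div hα₀ hα₁ hc (z * l) c)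
    (intervalIntegrable_kernel_div hα₀ hα₁ hc c (c * l)),
    intervalIntegral.integral_zero_ae (a := c), add_zero]
  refine Eventually.of_forall fun w hw => ?_
  rw [uIoc_of_le (le_mul_of_one_le_right hc.le hl)] at hw
  exact kernel_of_one_le ((one_le_div hc).2 hw.1.le)

lemma integral_beta_kernel (hα₀ : 0 < α) (hα₁ : α < 1) {c y : ℝ} (hy : 0 < y) (h : y < c) :
    ∫ θ in (0 : ℝ)..1, (1 - θ) ^ (α - 1) * θ ^ (-α) * kernel α (y * θ ^ (-(α / 2)) / c) =
      Real.Gamma α := by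
  have hc := hy.trans h
  have hyc : 0 < y / c := by positivity
  -- `σ` is the value of `θ` at which the argument of the kernel equals `1`. Above it the kernel is
  -- `(1 - σ/θ)^(-α) / Γ(1-α)`, and `θ^(-α)` clears the denominator.
  set σ := (y / c) ^ (2 / α) with hσ
  have hσ0 : 0 < σ := by positivity
  have hσ1 : σ < 1 := Real.rpow_lt_one hyc.le ((div_lt_one hc).2 h) (by positivity)
  have hyσ : y / c = σ ^ (α / 2) := by
    rw [hσ, ← Real.rpow_mul hyc.le]
    have e : 2 / α * (α / 2) = 1 := by field_simp
    rw [e, Real.rpow_one]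
  have harg : ∀ θ, 0 < θ → y * θ ^ (-(α / 2)) / c = (σ / θ) ^ (α / 2) := by
    intro θ hθ
    rw [Real.div_rpow hσ0.le hθ.le, ← hyσ, Real.rpow_neg hθ.le]
    ring
  have hΓ := gamma_one_sub_pos hα₁
  rw [intervalIntegral.integral_of_le zero_le_one]
  have hsub : Ioc σ 1 ⊆ Ioc 0 1 := Ioc_subset_Ioc_left hσ0.le
  rw [setIntegral_eq_of_subset_of_forall_sdiff_eq_zero measurableSet_Ioc hsub,
    ← intervalIntegral.integral_of_le hσ1.le]
  · have : ∫ θ in σ..1, (1 - θ) ^ (α - 1) * θ ^ (-α) * kernel α (y * θ ^ (-(α / 2)) / c) =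
        ∫ θ in σ..1, 1 / Real.Gamma (1 - α) * ((1 - θ) ^ (α - 1) * (θ - σ) ^ (-α)) := by
      refine intervalIntegral.integral_congr_uIoo fun θ hθ => ?_
      rw [uIoo_of_le hσ1.le] at hθ
      have hθ0 := hσ0.trans hθ.1
      have hq : 0 < σ / θ := by positivity
      have hq1 : σ / θ < 1 := (div_lt_one hθ0).2 hθ.1
      have e : (1 - σ / θ) = (θ - σ) / θ := by field_simp
      rw [harg θ hθ0, kernel_of_mem ⟨by positivity, Real.rpow_lt_one hq.le hq1 (by positivity)⟩,
        ← Real.rpow_mul hq.le]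
      have e2 : α / 2 * (2 / α) = 1 := by field_simp
      rw [e2, Real.rpow_one, e, Real.div_rpow (sub_nonneg.2 hθ.1.le) hθ0.le]
      have := (Real.rpow_pos_of_pos hθ0 (-α)).ne'
      field_simp
    rw [this, intervalIntegral.integral_const_mul, integral_beta_shift hα₀ hα₁ hσ1]
    field_simp
  · intro θ hθ
    have hθσ : θ ≤ σ := by
      by_contra! h'
      exact hθ.2 ⟨h', hθ.1.2⟩
    rw [harg θ hθ.1.1, kernel_of_one_le, mul_zero]
    exact Real.one_le_rpow ((one_le_div hθ.1.1).2 hθσ) (by positivity)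

/-- After exchanging the integrals, the inner one is the constant `Γ(α)` by `integral_beta_kernel`.
Differentiating under the integral is avoided because the derivative of `E₁ α c` is unbounded at
`c`. -/
lemma fluxTransform_E₁ (hα₀ : 0 < α) (hα₁ : α < 1) {c z : ℝ} (hz : 0 < z) (h : z ≤ c) :
    fluxTransform α (E₁ α c) z = Real.Gamma α * (c - z) := by
  have hc := hz.trans_le h
  set f : ℝ → ℝ → ℝ := fun θ y =>
    (1 - θ) ^ (α - 1) * θ ^ (-α) * kernel α (y * θ ^ (-(α / 2)) / c) with hf
  have hnn : ∀ θ ∈ Ioc (0 : ℝ) 1, ∀ y, 0 ≤ f θ y := by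
    intro θ hθ y
    have := sub_nonneg.2 hθ.2
    have := hθ.1.le
    have := kernel_nonneg hα₀ hα₁ (y * θ ^ (-(α / 2)) / c)
    simp only [hf]
    positivity
  have hmeas : Measurable (Function.uncurry f) := by
    simp only [hf]
    unfold Function.uncurry
    fun_prop
  have hint : IntegrableOn (Function.uncurry f) (uIoc 0 1 ×ˢ uIoc z c) := by
    rw [uIoc_of_le h, uIoc_of_le zero_le_one, IntegrableOn, Measure.volume_eq_prod,
      ← Measure.prod_restrict, integrable_prod_iff' hmeas.aestronglyMeasurable]
    have hval : ∀ᵐ y ∂volume.restrict (Ioc z c),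
        ∫ θ in Ioc (0 : ℝ) 1, f θ y = Real.Gamma α := by
      rw [← Measure.restrict_congr_set (Ioo_ae_eq_Ioc (a := z) (b := c))]
      filter_upwards [ae_restrict_mem measurableSet_Ioo] with y hy
      rw [← intervalIntegral.integral_of_le zero_le_one]
      exact integral_beta_kernel hα₀ hα₁ (hz.trans hy.1) hy.2
    constructor
    · filter_upwards [hval] with y hy
      -- A non-integrable function has integral `0` by convention, whereas this integral is `Γ(α) >
      -- 0`.
      refine not_imp_comm.1 integral_undef ?_
      simp only [Function.uncurry]
      rw [hy]
      exact (Real.Gamma_pos_of_pos hα₀).ne'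
    · refine (integrable_const (Real.Gamma α)).congr ?_
      filter_upwards [hval] with y hy
      rw [← hy]
      refine setIntegral_congr_fun measurableSet_Ioc fun θ hθ => ?_
      exact (Real.norm_of_nonneg (hnn θ hθ y)).symm
  calc fluxTransform α (E₁ α c) z = ∫ θ in (0 : ℝ)..1, ∫ y in z..c, f θ y := by
        refine intervalIntegral.integral_congr_uIoo fun θ hθ => ?_
        rw [uIoo_of_le zero_le_one] at hθ
        simp only [hf, intervalIntegral.integral_const_mul]
        rw [E₁_mul_eq hα₀ hα₁ hc (one_le_rpow_neg_half hα₀ ⟨hθ.1, hθ.2.le⟩), ← mul_assoc,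
          weight_mul_rpow hθ.1]
    _ = ∫ y in z..c, ∫ θ in (0 : ℝ)..1, f θ y := intervalIntegral_intervalIntegral_swap hint
    _ = ∫ y in z..c, Real.Gamma α := by
        refine intervalIntegral.integral_congr_uIoo fun y hy => ?_
        rw [uIoo_of_le h] at hy
        exact integral_beta_kernel hα₀ hα₁ (hz.trans hy.1) hy.2
    _ = Real.Gamma α * (c - z) := by
        rw [intervalIntegral.integral_const, smul_eq_mul, mul_comm]

/-- The part of `N(c,·)` that is continuously differentiable up to the front. -/
def remainder (α c z : ℝ) : ℝ := resolvent α c z - E₁ α c z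

lemma remainder_of_le {c z : ℝ} (h : c ≤ z) : remainder α c z = 0 := by
  rw [remainder, resolvent_of_le h, E₁_of_le h, sub_zero]

lemma continuous_remainder (hα₀ : 0 < α) (hα₁ : α < 1) (c : ℝ) : Continuous (remainder α c) :=
  (continuous_resolvent_right hα₀ hα₁ c).sub (continuous_E_right hα₀ hα₁ 0 c)

lemma hasDerivAt_remainder (hα₀ : 0 < α) (hα₁ : α < 1) {c z : ℝ} (hc : 0 < c) (hz : 0 < z) :
    HasDerivAt (remainder α c) (-memory α c z) z := by
  refine (hasDerivAt_integral_memory hα₀ hα₁ hc hz).congr_of_eventuallyEq ?_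
  filter_upwards [Ioi_mem_nhds hz] with w hw
  rw [remainder, resolvent_eq_memory hα₀ hα₁ hc (le_of_lt hw), add_sub_cancel_left]

lemma exists_flux_bound (hα₀ : 0 < α) (hα₁ : α < 1) (c : ℝ) :
    ∃ B, ∀ p, 0 ≤ p → |E₁ α c p| ≤ B ∧ |remainder α c p| ≤ B := by
  obtain ⟨B, -, hB⟩ := exists_resolvent_bound hα₀ hα₁ c
  refine ⟨B, fun p hp => ?_⟩
  have h1 := hB p hp
  have h2 := E₁_le_resolvent hα₀ hα₁ c p
  have h3 := E₁_nonneg hα₀ hα₁ c p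
  rw [remainder, abs_le, abs_le]
  refine ⟨⟨?_, ?_⟩, ⟨?_, ?_⟩⟩ <;> linarith

lemma fluxTransform_resolvent (hα₀ : 0 < α) (hα₁ : α < 1) {c z : ℝ} (hz : 0 < z) (h : z ≤ c) :
    fluxTransform α (resolvent α c) z =
      Real.Gamma α * (c - z) + fluxTransform α (remainder α c) z := by
  obtain ⟨B, hB⟩ := exists_flux_bound hα₀ hα₁ c
  have hE₁ : Continuous (E₁ α c) := continuous_E_right hα₀ hα₁ 0 c
  rw [← fluxTransform_E₁ hα₀ hα₁ hz h, fluxTransform, fluxTransform, fluxTransform,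
    ← intervalIntegral.integral_add
      (intervalIntegrable_fluxTransform hα₀ hα₁ hE₁.measurable
        (fun p hp => (hB p hp).1) hz.le)
      (intervalIntegrable_fluxTransform hα₀ hα₁ (continuous_remainder hα₀ hα₁ c).measurable
        (fun p hp => (hB p hp).2) hz.le)]
  refine intervalIntegral.integral_congr fun θ _ => ?_
  simp only [remainder]
  ring

/-- Minus the derivative of the transform of the remainder. -/
def fluxRemainderDeriv (α c z : ℝ) : ℝ :=
  ∫ θ in (0 : ℝ)..1, weight α θ * (memory α c (z * θ ^ (-(α / 2))) * θ ^ (-(α / 2)))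

lemma fluxRemainderDeriv_integrand_bound (hα₀ : 0 < α) (hα₁ : α < 1) {c : ℝ} (hc : 0 < c) :
    (∀ z, 0 < z → AEStronglyMeasurable (fun θ => weight α θ *
      (memory α c (z * θ ^ (-(α / 2))) * θ ^ (-(α / 2)))) (volume.restrict (uIoc 0 1))) ∧
    ∃ B, ∀ z, 0 < z → ∀ θ ∈ uIoc (0 : ℝ) 1,
      ‖weight α θ * (memory α c (z * θ ^ (-(α / 2))) * θ ^ (-(α / 2)))‖ ≤
        (1 - θ) ^ (α - 1) * θ ^ (-α) * B := by
  constructor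
  · intro z hz
    refine measurable_weight.aestronglyMeasurable.mul
      (AEStronglyMeasurable.mul ?_ (Measurable.aestronglyMeasurable (by fun_prop)))
    refine ContinuousOn.aestronglyMeasurable ?_ measurableSet_uIoc
    rw [uIoc_of_le zero_le_one]
    refine (continuousOn_memory hα₀ hα₁ hc).comp (fun θ hθ => ?_) fun θ hθ => ?_
    · exact ContinuousAt.continuousWithinAt
        (continuousAt_const.mul (continuousAt_id.rpow_const (Or.inl hθ.1.ne')))
    · exact mul_pos hz (Real.rpow_pos_of_pos hθ.1 _)
  · obtain ⟨B, hB⟩ := exists_memory_bound hα₀ hα₁ hc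
    refine ⟨B, fun z hz θ hθ => ?_⟩
    rw [uIoc_of_le zero_le_one] at hθ
    have h1 : 0 < θ ^ (-(α / 2)) := Real.rpow_pos_of_pos hθ.1 _
    have hw := weight_nonneg (α := α) hθ
    rw [norm_mul, norm_mul, Real.norm_of_nonneg hw, Real.norm_of_nonneg h1.le,
      ← weight_mul_rpow hθ.1]
    have := hB _ (mul_pos hz h1)
    calc _ ≤ weight α θ * (B * θ ^ (-(α / 2))) := by gcongr
      _ = _ := by ring

/-- The chain rule contributes a factor `θ^(-α/2)`, which completes `weight` to the Beta density,
and `memory` is bounded; this dominates the derivative uniformly in `z > 0`. -/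
lemma hasDerivAt_fluxTransform_remainder (hα₀ : 0 < α) (hα₁ : α < 1) {c z : ℝ} (hc : 0 < c)
    (hz : 0 < z) :
    HasDerivAt (fluxTransform α (remainder α c)) (-fluxRemainderDeriv α c z) z := by
  obtain ⟨B, hB⟩ := exists_flux_bound hα₀ hα₁ c
  obtain ⟨hm, B', hB'⟩ := fluxRemainderDeriv_integrand_bound hα₀ hα₁ hc
  have h := (intervalIntegral.hasDerivAt_integral_of_dominated_loc_of_deriv_le (μ := volume)
    (F := fun z θ => weight α θ * remainder α c (z * θ ^ (-(α / 2))))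
    (F' := fun z θ => -(weight α θ * (memory α c (z * θ ^ (-(α / 2))) * θ ^ (-(α / 2)))))
    (bound := fun θ => (1 - θ) ^ (α - 1) * θ ^ (-α) * B')
    (a := 0) (b := 1) (x₀ := z) (s := Ioi 0) (Ioi_mem_nhds hz) ?_ ?_ (hm z hz).neg ?_
    ((intervalIntegrable_beta hα₀ hα₁).mul_const B') ?_).2
  · rw [intervalIntegral.integral_neg] at h
    exact h
  · refine Eventually.of_forall fun z => Measurable.aestronglyMeasurable ?_
    have := (continuous_remainder hα₀ hα₁ c).measurable
    fun_prop
  · exact intervalIntegrable_fluxTransform hα₀ hα₁ (continuous_remainder hα₀ hα₁ c).measurable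
        (fun p hp => (hB p hp).2) hz.le
  · refine Eventually.of_forall fun θ hθ z hz => ?_
    rw [norm_neg]
    exact hB' z hz θ hθ
  · refine Eventually.of_forall fun θ hθ x hx => ?_
    rw [uIoc_of_le zero_le_one] at hθ
    have h1 : 0 < θ ^ (-(α / 2)) := Real.rpow_pos_of_pos hθ.1 _
    have h2 := ((hasDerivAt_remainder hα₀ hα₁ hc (mul_pos hx h1)).comp x
      ((hasDerivAt_id x).mul_const _)).const_mul (weight α θ)
    refine h2.congr_deriv ?_
    simp only [one_mul, neg_mul, mul_neg]

lemma continuousAt_fluxRemainderDeriv (hα₀ : 0 < α) (hα₁ : α < 1) {c z : ℝ} (hc : 0 < c)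
    (hz : 0 < z) : ContinuousAt (fluxRemainderDeriv α c) z := by
  obtain ⟨hm, B', hB'⟩ := fluxRemainderDeriv_integrand_bound hα₀ hα₁ hc
  refine intervalIntegral.continuousAt_of_dominated_interval
    (bound := fun θ => (1 - θ) ^ (α - 1) * θ ^ (-α) * B') ?_ ?_
    ((intervalIntegrable_beta hα₀ hα₁).mul_const B') ?_
  · filter_upwards [Ioi_mem_nhds hz] with x hx using hm x hx
  · filter_upwards [Ioi_mem_nhds hz] with x hx
    exact Eventually.of_forall fun θ hθ => hB' x hx θ hθ
  · refine Eventually.of_forall fun θ hθ => ?_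
    rw [uIoc_of_le zero_le_one] at hθ
    have h1 : 0 < θ ^ (-(α / 2)) := Real.rpow_pos_of_pos hθ.1 _
    refine continuousAt_const.mul (ContinuousAt.mul ?_ continuousAt_const)
    exact ContinuousAt.comp (f := fun z => z * θ ^ (-(α / 2)))
      ((continuousOn_memory hα₀ hα₁ hc).continuousAt (Ioi_mem_nhds (mul_pos hz h1)))
      (by fun_prop)

/-- At `z = c` every argument `c θ^(-α/2)` lies at or beyond the front, where `memory` vanishes. -/
lemma fluxRemainderDeriv_self (hα₀ : 0 < α) {c : ℝ} (hc : 0 < c) :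
    fluxRemainderDeriv α c c = 0 := by
  refine intervalIntegral.integral_zero_ae (Eventually.of_forall fun θ hθ => ?_)
  rw [uIoc_of_le zero_le_one] at hθ
  rw [memory_of_le hc (le_mul_of_one_le_right hc.le (one_le_rpow_neg_half hα₀ hθ)), zero_mul,
    mul_zero]

lemma fluxTransform_remainder_self (hα₀ : 0 < α) {c : ℝ} (hc : 0 < c) :
    fluxTransform α (remainder α c) c = 0 := by
  refine intervalIntegral.integral_zero_ae (Eventually.of_forall fun θ hθ => ?_)
  rw [uIoc_of_le zero_le_one] at hθ
  rw [remainder_of_le (le_mul_of_one_le_right hc.le (one_le_rpow_neg_half hα₀ hθ)), mul_zero]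

lemma hasDerivAt_fluxTransform (hα₀ : 0 < α) (hα₁ : α < 1) {c z : ℝ} (hz : 0 < z) (h : z < c) :
    HasDerivAt (fluxTransform α (resolvent α c))
      (-(Real.Gamma α + fluxRemainderDeriv α c z)) z := by
  have h1 := (((hasDerivAt_id z).const_sub c).const_mul (Real.Gamma α)).add
    (hasDerivAt_fluxTransform_remainder hα₀ hα₁ (hz.trans h) hz)
  refine (h1.congr_deriv (by ring)).congr_of_eventuallyEq ?_
  filter_upwards [Ioo_mem_nhds hz h] with w hw
  exact fluxTransform_resolvent hα₀ hα₁ hw.1 hw.2.le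

lemma tendsto_fluxTransform (hα₀ : 0 < α) (hα₁ : α < 1) {c : ℝ} (hc : 0 < c) :
    Tendsto (fluxTransform α (resolvent α c)) (𝓝[<] c) (𝓝 0) := by
  have h1 : ContinuousAt
      (fun z => Real.Gamma α * (c - z) + fluxTransform α (remainder α c) z) c :=
    ContinuousAt.add (by fun_prop)
      (hasDerivAt_fluxTransform_remainder hα₀ hα₁ hc hc).continuousAt
  have h2 := h1.tendsto.mono_left (nhdsWithin_le_nhds (s := Iio c))
  simp only [sub_self, mul_zero, fluxTransform_remainder_self hα₀ hc, add_zero] at h2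
  refine h2.congr' ?_
  filter_upwards [Ioo_mem_nhdsLT hc] with w hw
  exact (fluxTransform_resolvent hα₀ hα₁ hw.1 hw.2.le).symm

/-! ### Absolute continuity and weak derivatives -/

lemma absolutelyContinuousOnInterval_congr {f g : ℝ → ℝ} {a b : ℝ}
    (hf : AbsolutelyContinuousOnInterval f a b) (h : EqOn f g (uIcc a b)) :
    AbsolutelyContinuousOnInterval g a b := by
  rw [absolutelyContinuousOnInterval_iff] at hf ⊢
  intro ε hε
  obtain ⟨δ, hδ, H⟩ := hf ε hε
  refine ⟨δ, hδ, fun I hI hI' => ?_⟩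
  convert H I hI hI' using 1
  refine Finset.sum_congr rfl fun i hi => ?_
  rw [h (hI.1 i hi).1, h (hI.1 i hi).2]

/-- The sign replaces any growth estimate: the integral of the derivative is bounded by the
increment of `f`. This handles `u_xx`, which is singular at the front. -/
lemma intervalIntegrable_of_deriv_nonneg {f f' : ℝ → ℝ} {a b : ℝ} (hab : a ≤ b)
    (hc : ContinuousOn f (Icc a b)) (hd : ∀ x ∈ Ioo a b, HasDerivAt f (f' x) x)
    (hn : ∀ x ∈ Ioo a b, 0 ≤ f' x) : IntervalIntegrable f' volume a b :=
  intervalIntegral.intervalIntegrable_deriv_of_nonneg (by rwa [uIcc_of_le hab])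
    (by rwa [min_eq_left hab, max_eq_right hab]) (by rwa [min_eq_left hab, max_eq_right hab])

/-- A continuous function on a compact interval with nonnegative derivative in the interior is
absolutely continuous. -/
lemma absolutelyContinuousOnInterval_of_deriv_nonneg {f f' : ℝ → ℝ} {a b : ℝ} (hab : a ≤ b)
    (hc : ContinuousOn f (Icc a b)) (hd : ∀ x ∈ Ioo a b, HasDerivAt f (f' x) x)
    (hn : ∀ x ∈ Ioo a b, 0 ≤ f' x) : AbsolutelyContinuousOnInterval f a b := by
  have hi := intervalIntegrable_of_deriv_nonneg hab hc hd hn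
  have hK : AbsolutelyContinuousOnInterval (fun _ : ℝ => f a) a b :=
    (LipschitzWith.const (f a)).lipschitzOnWith.absolutelyContinuousOnInterval
  refine absolutelyContinuousOnInterval_congr
    (hK.add (hi.absolutelyContinuousOnInterval_intervalIntegral left_mem_uIcc)) fun x hx => ?_
  rw [uIcc_of_le hab] at hx
  rw [Pi.add_apply, intervalIntegral.integral_eq_sub_of_hasDerivAt_of_le hx.1
    (hc.mono (Icc_subset_Icc_right hx.2)) (fun y hy => hd y ⟨hy.1, hy.2.trans_le hx.2⟩)
    (hi.mono_set (by rw [uIcc_of_le hab, uIcc_of_le hx.1]; exact Icc_subset_Icc_right hx.2))]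
  ring

lemma integral_Ioo_mul_deriv {f f' ψ ψ' : ℝ → ℝ} {a b : ℝ} (hab : a ≤ b)
    (hf : ContinuousOn f (Icc a b)) (hd : ∀ x ∈ Ioo a b, HasDerivAt f (f' x) x)
    (hi : IntervalIntegrable f' volume a b) (hψ : ∀ x, HasDerivAt ψ (ψ' x) x)
    (hψ' : Continuous ψ') (ha : ψ a = 0) (hb : ψ b = 0) :
    ∫ x in Ioo a b, f x * ψ' x = -∫ x in Ioo a b, f' x * ψ x := by
  rw [← integral_Ioc_eq_integral_Ioo, ← integral_Ioc_eq_integral_Ioo,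
    ← intervalIntegral.integral_of_le hab, ← intervalIntegral.integral_of_le hab,
    intervalIntegral.integral_mul_deriv_eq_deriv_mul_of_hasDerivAt (u' := f')
      (by rwa [uIcc_of_le hab]) (fun x _ => (hψ x).continuousAt.continuousWithinAt)
      (by rwa [min_eq_left hab, max_eq_right hab]) (fun x _ => hψ x) hi
      (hψ'.intervalIntegrable _ _), ha, hb]
  ring

/-- A function on a compact interval that is twice differentiable in the interior, with `f` and
`f'` continuous up to the boundary and `f''` integrable, belongs to `W^{2,1}`. -/
lemma memW_two_one {f f' f'' : ℝ → ℝ} {a b : ℝ} (hab : a ≤ b)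
    (hf : ContinuousOn f (Icc a b)) (hf' : ContinuousOn f' (Icc a b))
    (hd : ∀ x ∈ Ioo a b, HasDerivAt f (f' x) x) (hd' : ∀ x ∈ Ioo a b, HasDerivAt f' (f'' x) x)
    (hi : IntervalIntegrable f'' volume a b) : MemW 2 1 a b f := by
  have hi' : IntervalIntegrable f' volume a b :=
    ContinuousOn.intervalIntegrable (by rwa [uIcc_of_le hab])
  have hmem {φ : ℝ → ℝ} (h : IntervalIntegrable φ volume a b) :
      MemLp φ 1 (volume.restrict (Ioo a b)) :=
    memLp_one_iff_integrable.2
      ((intervalIntegrable_iff_integrableOn_Ioo_of_le hab).1 h)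
  have hf1 : MemLp f 1 (volume.restrict (Ioo a b)) :=
    hmem (ContinuousOn.intervalIntegrable (by rwa [uIcc_of_le hab]))
  have hder {φ : ℝ → ℝ} (hφ : ContDiff ℝ ∞ φ) (k : ℕ) (x : ℝ) :
      HasDerivAt (iteratedDeriv k φ) (iteratedDeriv (k + 1) φ x) x := by
    rw [iteratedDeriv_succ]
    exact ((hφ.differentiable_iteratedDeriv k (by exact_mod_cast WithTop.coe_lt_top _))
      x).hasDerivAt
  have hcont {φ : ℝ → ℝ} (hφ : ContDiff ℝ ∞ φ) (k : ℕ) : Continuous (iteratedDeriv k φ) :=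
    hφ.continuous_iteratedDeriv k (by exact_mod_cast le_top)
  -- The endpoints lie outside the support of a test function, so all boundary terms vanish.
  have hzero {φ : ℝ → ℝ} (h : tsupport φ ⊆ Ioo a b) {x : ℝ} (hx : x ∉ Ioo a b) :
      φ x = 0 ∧ deriv φ x = 0 :=
    ⟨image_eq_zero_of_notMem_tsupport fun h' => hx (h h'),
      Function.notMem_support.1 fun h' => hx (h (support_deriv_subset h'))⟩
  have ha : a ∉ Ioo a b := by simp
  have hb : b ∉ Ioo a b := by simp
  have h1 : IsWeakDeriv 1 a b f f' := by
    intro φ hφ _ hs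
    rw [integral_Ioo_mul_deriv hab hf hd hi' (ψ := φ)
      (fun x => by simpa using hder hφ 0 x) (hcont hφ 1) (hzero hs ha).1 (hzero hs hb).1]
    ring
  refine ⟨hf1, fun j hj => ?_⟩
  interval_cases j
  · refine ⟨f, hf1, fun φ _ _ _ => ?_⟩
    simp
  · exact ⟨f', hmem hi', h1⟩
  · refine ⟨f'', hmem hi, fun φ hφ _ hs => ?_⟩
    rw [integral_Ioo_mul_deriv hab hf hd hi' (fun x => hder hφ 1 x) (hcont hφ 2)
        (by rw [iteratedDeriv_one]; exact (hzero hs ha).2)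
        (by rw [iteratedDeriv_one]; exact (hzero hs hb).2),
      integral_Ioo_mul_deriv hab hf' hd' hi (ψ := φ)
        (fun x => by simpa using hder hφ 0 x) (hcont hφ 1) (hzero hs ha).1 (hzero hs hb).1]
    ring

/-! ### The self-similar solution -/

/-- The profile of the self-similar solution. -/
def profile (α c z : ℝ) : ℝ := ∫ w in z..c, resolvent α c w

/-- The self-similar temperature. -/
def temp (α c x t : ℝ) : ℝ := profile α c (x * t ^ (-(α / 2)))

/-- The self-similar interface. -/
def front (α c t : ℝ) : ℝ := c * t ^ (α / 2)

lemma hasDerivAt_profile (hα₀ : 0 < α) (hα₁ : α < 1) (z : ℝ) :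
    HasDerivAt (profile α c) (-resolvent α c z) z := by
  have h := continuous_resolvent_right hα₀ hα₁ c
  exact intervalIntegral.integral_hasDerivAt_left (h.intervalIntegrable _ _)
    h.measurable.stronglyMeasurable.stronglyMeasurableAtFilter h.continuousAt

lemma continuous_profile (hα₀ : 0 < α) (hα₁ : α < 1) : Continuous (profile α c) :=
  continuous_iff_continuousAt.2 fun z => (hasDerivAt_profile hα₀ hα₁ z).continuousAt

lemma profile_pos (hα₀ : 0 < α) (hα₁ : α < 1) {z : ℝ} (hz : 0 ≤ z) (h : z < c) :
    0 < profile α c z :=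
  intervalIntegral.intervalIntegral_pos_of_pos_on
    ((continuous_resolvent_right hα₀ hα₁ c).intervalIntegrable _ _)
    (fun _ hw => resolvent_pos hα₀ hα₁ (hz.trans hw.1.le) hw.2) h

lemma front_mul {t : ℝ} (ht : 0 < t) : front α c t * t ^ (-(α / 2)) = c := by
  rw [front, mul_assoc, ← Real.rpow_add ht, add_neg_cancel, Real.rpow_zero, mul_one]

lemma mul_rpow_le_iff {x t : ℝ} (ht : 0 < t) : x * t ^ (-(α / 2)) ≤ c ↔ x ≤ front α c t := by
  nth_rw 1 [← front_mul (α := α) (c := c) ht]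
  exact mul_le_mul_iff_left₀ (Real.rpow_pos_of_pos ht _)

lemma mul_rpow_lt_iff {x t : ℝ} (ht : 0 < t) : x * t ^ (-(α / 2)) < c ↔ x < front α c t := by
  nth_rw 1 [← front_mul (α := α) (c := c) ht]
  exact mul_lt_mul_iff_left₀ (Real.rpow_pos_of_pos ht _)

lemma front_pos (hc : 0 < c) {t : ℝ} (ht : 0 < t) : 0 < front α c t :=
  mul_pos hc (Real.rpow_pos_of_pos ht _)

lemma continuous_front (hα₀ : 0 < α) : Continuous (front α c) :=
  continuous_const.mul (Real.continuous_rpow_const (by positivity))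

lemma strictMonoOn_front (hα₀ : 0 < α) (hc : 0 < c) : StrictMonoOn (front α c) (Ici 0) :=
  fun _ ha _ _ hab =>
    mul_lt_mul_of_pos_left (Real.rpow_lt_rpow ha hab (by positivity)) hc

lemma hasDerivAt_front {t : ℝ} (ht : 0 < t) :
    HasDerivAt (front α c) (c * (α / 2 * t ^ (α / 2 - 1))) t :=
  (Real.hasDerivAt_rpow_const (Or.inl ht.ne')).const_mul c

lemma front_zero (hα₀ : 0 < α) : front α c 0 = 0 := by
  rw [front, Real.zero_rpow (by positivity), mul_zero]

lemma sInv_front_apply (hα₀ : 0 < α) (hc : 0 < c) {t : ℝ} (ht : 0 ≤ t) :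
    sInv (front α c) (front α c t) = t :=
  (strictMonoOn_front hα₀ hc).injOn.leftInvOn_invFunOn ht

lemma front_rpow (hα₀ : 0 < α) (hc : 0 < c) {x : ℝ} (hx : 0 ≤ x) :
    front α c ((x / c) ^ (2 / α)) = x := by
  have e : 2 / α * (α / 2) = 1 := by field_simp
  rw [front, ← Real.rpow_mul (by positivity), e, Real.rpow_one]
  field_simp

lemma sInv_front (hα₀ : 0 < α) (hc : 0 < c) {x : ℝ} (hx : 0 ≤ x) :
    sInv (front α c) x = (x / c) ^ (2 / α) := by
  have h := sInv_front_apply hα₀ hc (t := (x / c) ^ (2 / α)) (by positivity)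
  rwa [front_rpow hα₀ hc hx] at h

lemma sInv_front_pos (hα₀ : 0 < α) (hc : 0 < c) {x : ℝ} (hx : 0 < x) :
    0 < sInv (front α c) x := by
  rw [sInv_front hα₀ hc hx.le]
  positivity

lemma front_sInv (hα₀ : 0 < α) (hc : 0 < c) {x : ℝ} (hx : 0 ≤ x) :
    front α c (sInv (front α c) x) = x := by
  rw [sInv_front hα₀ hc hx, front_rpow hα₀ hc hx]

lemma sInv_le_iff (hα₀ : 0 < α) (hc : 0 < c) {x t : ℝ} (hx : 0 ≤ x) (ht : 0 ≤ t) :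
    sInv (front α c) x ≤ t ↔ x ≤ front α c t := by
  have h0 : 0 ≤ sInv (front α c) x := by
    rw [sInv_front hα₀ hc hx]
    positivity
  rw [← (strictMonoOn_front hα₀ hc).le_iff_le h0 ht, front_sInv hα₀ hc hx]

lemma sInv_lt_iff (hα₀ : 0 < α) (hc : 0 < c) {x t : ℝ} (hx : 0 ≤ x) (ht : 0 ≤ t) :
    sInv (front α c) x < t ↔ x < front α c t := by
  have h0 : 0 ≤ sInv (front α c) x := by
    rw [sInv_front hα₀ hc hx]
    positivity
  rw [← (strictMonoOn_front hα₀ hc).lt_iff_lt h0 ht, front_sInv hα₀ hc hx]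

lemma hasDerivAt_rpow_neg_half {t : ℝ} (ht : 0 < t) :
    HasDerivAt (fun t : ℝ => t ^ (-(α / 2))) (-(α / 2) * t ^ (-(α / 2) - 1)) t :=
  Real.hasDerivAt_rpow_const (Or.inl ht.ne')

lemma hasDerivAt_temp_space (hα₀ : 0 < α) (hα₁ : α < 1) (x t : ℝ) :
    HasDerivAt (fun y => temp α c y t)
      (-(t ^ (-(α / 2)) * resolvent α c (x * t ^ (-(α / 2))))) x := by
  have := (hasDerivAt_profile (c := c) hα₀ hα₁ (x * t ^ (-(α / 2)))).comp x
    ((hasDerivAt_id x).mul_const (t ^ (-(α / 2))))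
  refine this.congr_deriv ?_
  ring

lemma hasDerivAt_temp_time (hα₀ : 0 < α) (hα₁ : α < 1) (x : ℝ) {t : ℝ} (ht : 0 < t) :
    HasDerivAt (fun τ => temp α c x τ)
      (α / 2 * x * t ^ (-(α / 2) - 1) * resolvent α c (x * t ^ (-(α / 2)))) t := by
  have := (hasDerivAt_profile (c := c) hα₀ hα₁ (x * t ^ (-(α / 2)))).comp t
    ((hasDerivAt_rpow_neg_half ht).const_mul x)
  refine this.congr_deriv ?_
  ring

/-- The profile is continuously differentiable on the whole line, so the one-sided derivatives at
the ends of `[0, s(t)]` are restrictions of two-sided ones. -/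
lemma ux_temp (hα₀ : 0 < α) (hα₁ : α < 1) (hc : 0 < c) {x t : ℝ} (ht : 0 < t)
    (hx : x ∈ Icc 0 (front α c t)) :
    ux (temp α c) (front α c) x t =
      -(t ^ (-(α / 2)) * resolvent α c (x * t ^ (-(α / 2)))) :=
  (hasDerivAt_temp_space hα₀ hα₁ x t).hasDerivWithinAt.derivWithin
    (uniqueDiffOn_Icc (front_pos hc ht) x hx)

lemma ut_temp (hα₀ : 0 < α) (hα₁ : α < 1) {x t : ℝ} (ht : 0 < t)
    (hx : sInv (front α c) x ≤ t) :
    ut (temp α c) (front α c) x t =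
      α / 2 * x * t ^ (-(α / 2) - 1) * resolvent α c (x * t ^ (-(α / 2))) :=
  (hasDerivAt_temp_time hα₀ hα₁ x ht).hasDerivWithinAt.derivWithin
    (uniqueDiffOn_Ici _ t hx)

lemma continuousOn_mul_rpow (x : ℝ) (r : ℝ) : ContinuousOn (fun τ : ℝ => x * τ ^ r) (Ioi 0) :=
  fun _ hτ => (continuousAt_const.mul
    (continuousAt_id.rpow_const (Or.inl (ne_of_gt hτ)))).continuousWithinAt

lemma continuousOn_resolvent_time (hα₀ : 0 < α) (hα₁ : α < 1) (x : ℝ) :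
    ContinuousOn (fun τ : ℝ => resolvent α c (x * τ ^ (-(α / 2)))) (Ioi 0) :=
  (continuous_resolvent_right hα₀ hα₁ c).comp_continuousOn (continuousOn_mul_rpow x _)

lemma continuousOn_ux_time (hα₀ : 0 < α) (hα₁ : α < 1) (hc : 0 < c) {x : ℝ} (hx : 0 < x) :
    ContinuousOn (fun τ => ux (temp α c) (front α c) x τ) (Ici (sInv (front α c) x)) := by
  have hσ := sInv_front_pos hα₀ hc hx
  have h : ContinuousOn (fun τ : ℝ => -(1 * τ ^ (-(α / 2)) *
      resolvent α c (x * τ ^ (-(α / 2))))) (Ici (sInv (front α c) x)) :=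
    (((continuousOn_mul_rpow 1 _).mul (continuousOn_resolvent_time hα₀ hα₁ x)).neg).mono
      (Ici_subset_Ioi.2 hσ)
  refine h.congr fun τ hτ => ?_
  have hτ0 := hσ.trans_le hτ
  simp only [one_mul]
  rw [ux_temp hα₀ hα₁ hc hτ0 ⟨hx.le, (sInv_le_iff hα₀ hc hx.le hτ0.le).1 hτ⟩]

lemma continuousOn_ut_time (hα₀ : 0 < α) (hα₁ : α < 1) (hc : 0 < c) {x : ℝ} (hx : 0 < x) :
    ContinuousOn (fun τ => ut (temp α c) (front α c) x τ) (Ici (sInv (front α c) x)) := by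
  have hσ := sInv_front_pos hα₀ hc hx
  have h : ContinuousOn (fun τ : ℝ => α / 2 * x * τ ^ (-(α / 2) - 1) *
      resolvent α c (x * τ ^ (-(α / 2)))) (Ici (sInv (front α c) x)) :=
    ((continuousOn_mul_rpow _ _).mul (continuousOn_resolvent_time hα₀ hα₁ x)).mono
      (Ici_subset_Ioi.2 hσ)
  exact h.congr fun τ hτ => ut_temp hα₀ hα₁ (hσ.trans_le hτ) hτ

lemma hasDerivAt_ux_space (hα₀ : 0 < α) (hα₁ : α < 1) {x t : ℝ} (ht : 0 < t) (hx : 0 < x)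
    (h : x < front α c t) :
    HasDerivAt (fun y => -(t ^ (-(α / 2)) * resolvent α c (y * t ^ (-(α / 2)))))
      (t ^ (-α) * profileDeriv₂ α c (x * t ^ (-(α / 2)))) x := by
  have hr : 0 < t ^ (-(α / 2)) := Real.rpow_pos_of_pos ht _
  have := (((hasDerivAt_resolvent hα₀ hα₁ (mul_pos hx hr) ((mul_rpow_lt_iff ht).2 h)).comp x
    ((hasDerivAt_id x).mul_const (t ^ (-(α / 2))))).const_mul (t ^ (-(α / 2)))).neg
  refine this.congr_deriv ?_
  rw [← rpow_neg_half_mul_self (α := α) ht]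
  ring

lemma hasDerivAt_ux (hα₀ : 0 < α) (hα₁ : α < 1) (hc : 0 < c) {x t : ℝ} (ht : 0 < t) (hx : 0 < x)
    (h : x < front α c t) :
    HasDerivAt (fun y => ux (temp α c) (front α c) y t)
      (t ^ (-α) * profileDeriv₂ α c (x * t ^ (-(α / 2)))) x := by
  refine (hasDerivAt_ux_space hα₀ hα₁ ht hx h).congr_of_eventuallyEq ?_
  filter_upwards [Ioo_mem_nhds hx h] with y hy
  exact ux_temp hα₀ hα₁ hc ht ⟨hy.1.le, hy.2.le⟩

lemma intervalIntegrable_sub_rpow {r : ℝ} (hr : -1 < r) (a t : ℝ) :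
    IntervalIntegrable (fun τ : ℝ => (t - τ) ^ r) volume a t := by
  have := (intervalIntegral.intervalIntegrable_rpow' (a := 0) (b := t - a) hr).comp_sub_left t
  simpa using this.symm

/-! ### The fractional derivative -/

/-- The decreasing substitution `p = x τ^(-α/2)` maps `(s⁻¹(x), t)` onto `(z, c)`. Its Jacobian is
the prefactor of `u_t`, and `z/p = (τ/t)^(α/2)` turns the kernel into a multiple of
`((t-τ)/t)^(-α)`. -/
lemma caputo_temp (hα₀ : 0 < α) (hα₁ : α < 1) (hc : 0 < c) {x t : ℝ} (ht : 0 < t) (hx : 0 < x)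
    (h : x < front α c t) :
    caputo α (temp α c) (front α c) x t = t ^ (-α) * memory α c (x * t ^ (-(α / 2))) := by
  set σ := sInv (front α c) x with hσdef
  have hσ : 0 < σ := sInv_front_pos hα₀ hc hx
  have hσt : σ < t := (sInv_lt_iff hα₀ hc hx.le ht.le).2 h
  set f : ℝ → ℝ := fun τ => x * τ ^ (-(α / 2)) with hf
  have hanti : StrictAntiOn f (Ioi 0) := fun a ha b _ hab =>
    mul_lt_mul_of_pos_left (Real.rpow_lt_rpow_of_neg ha hab (by linarith)) hx
  have hfσ : f σ = c := by
    have := front_mul (α := α) (c := c) hσ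
    rwa [hσdef, front_sInv hα₀ hc hx.le] at this
  have hz : 0 < f t := mul_pos hx (Real.rpow_pos_of_pos ht _)
  have hzc : f t < c := (mul_rpow_lt_iff ht).2 h
  have himg : f '' Ioo σ t = Ioo (f t) c := by
    ext p
    constructor
    · rintro ⟨τ, hτ, rfl⟩
      have hτ0 : 0 < τ := hσ.trans hτ.1
      exact ⟨hanti hτ0 ht hτ.2, hfσ ▸ hanti hσ hτ0 hτ.1⟩
    · intro hp
      have hp0 := hz.trans hp.1
      have hxp : 0 < x / p := by positivity
      have hτ0 : 0 < (x / p) ^ (2 / α) := by positivity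
      have hfτ : f ((x / p) ^ (2 / α)) = p := by
        have e : 2 / α * -(α / 2) = -1 := by field_simp
        simp only [hf]
        rw [← Real.rpow_mul hxp.le, e, Real.rpow_neg_one]
        field_simp
      refine ⟨_, ⟨?_, ?_⟩, hfτ⟩
      · rw [← hanti.lt_iff_gt hτ0 hσ, hfσ, hfτ]
        exact hp.2
      · rw [← hanti.lt_iff_gt ht hτ0, hfτ]
        exact hp.1
  have hsub : ∫ p in f '' Ioo σ t, kernel α (f t / p) * resolvent α c p =
      ∫ τ in Ioo σ t, |x * (-(α / 2) * τ ^ (-(α / 2) - 1))| •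
        (kernel α (f t / f τ) * resolvent α c (f τ)) :=
    integral_image_eq_integral_abs_deriv_smul measurableSet_Ioo
      (fun τ hτ => ((hasDerivAt_rpow_neg_half (hσ.trans hτ.1)).const_mul x).hasDerivWithinAt)
      (hanti.injOn.mono fun τ hτ => hσ.trans hτ.1) _
  have hmem : memory α c (f t) = ∫ p in Ioo (f t) c, kernel α (f t / p) * resolvent α c p := by
    rw [memory, integral_kernel_mul_resolvent hz.le hc.le hz.le le_rfl,
      ← integral_kernel_mul_resolvent hz.le hzc.le le_rfl le_rfl,
      intervalIntegral.integral_of_le hzc.le, integral_Ioc_eq_integral_Ioo]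
  have hΓ := gamma_one_sub_pos hα₁
  change _ = t ^ (-α) * memory α c (f t)
  rw [hmem, ← himg, hsub, caputo, ← hσdef, intervalIntegral.integral_of_le hσt.le,
    integral_Ioc_eq_integral_Ioo, ← integral_const_mul, ← integral_const_mul]
  refine setIntegral_congr_fun measurableSet_Ioo fun τ hτ => ?_
  have hτ0 : 0 < τ := hσ.trans hτ.1
  have hq : 0 < τ / t := by positivity
  have hq1 : τ / t < 1 := (div_lt_one ht).2 hτ.2
  have harg : f t / f τ = (τ / t) ^ (α / 2) := by
    simp only [hf]
    rw [Real.div_rpow hτ0.le ht.le, Real.rpow_neg ht.le, Real.rpow_neg hτ0.le]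
    have := (Real.rpow_pos_of_pos ht (α / 2)).ne'
    have := (Real.rpow_pos_of_pos hτ0 (α / 2)).ne'
    field_simp
  have habs : |x * (-(α / 2) * τ ^ (-(α / 2) - 1))| = α / 2 * x * τ ^ (-(α / 2) - 1) := by
    rw [show x * (-(α / 2) * τ ^ (-(α / 2) - 1)) = -(α / 2 * x * τ ^ (-(α / 2) - 1)) by ring,
      abs_neg, abs_of_nonneg (by positivity)]
  have e2 : α / 2 * (2 / α) = 1 := by field_simp
  have e3 : 1 - τ / t = (t - τ) / t := by field_simp
  have hk : kernel α (f t / f τ) =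
      1 / Real.Gamma (1 - α) * ((t - τ) ^ (-α) / t ^ (-α)) := by
    rw [harg, kernel_of_mem ⟨by positivity, Real.rpow_lt_one hq.le hq1 (by positivity)⟩,
      ← Real.rpow_mul hq.le, e2, Real.rpow_one, e3,
      Real.div_rpow (sub_nonneg.2 hτ.2.le) ht.le]
  rw [hk, habs, ut_temp hα₀ hα₁ hτ0 hτ.1.le, smul_eq_mul]
  have := (Real.rpow_pos_of_pos ht (-α)).ne'
  simp only [hf]
  field_simp

/-- The exponents are matched so that `(z/c)^(2/α) = s⁻¹(x)/t`. -/
lemma kernel_front (hα₀ : 0 < α) (hc : 0 < c) {x t : ℝ} (ht : 0 < t) (hx : 0 < x)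
    (h : x < front α c t) :
    t ^ (-α) * kernel α (x * t ^ (-(α / 2)) / c) =
      1 / Real.Gamma (1 - α) * (t - sInv (front α c) x) ^ (-α) := by
  have hr : 0 < t ^ (-(α / 2)) := Real.rpow_pos_of_pos ht _
  have hσt := (sInv_lt_iff hα₀ hc hx.le ht.le).2 h
  have e : (x * t ^ (-(α / 2)) / c) ^ (2 / α) = sInv (front α c) x / t := by
    have e2 : -(α / 2) * (2 / α) = -1 := by field_simp
    rw [sInv_front hα₀ hc hx.le, show x * t ^ (-(α / 2)) / c = x / c * t ^ (-(α / 2)) by ring,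
      Real.mul_rpow (by positivity) hr.le, ← Real.rpow_mul ht.le, e2, Real.rpow_neg_one]
    rfl
  have e3 : 1 - sInv (front α c) x / t = (t - sInv (front α c) x) / t := by field_simp
  rw [kernel_of_mem ⟨by positivity, (div_lt_one hc).2 ((mul_rpow_lt_iff ht).2 h)⟩, e, e3,
    Real.div_rpow (sub_nonneg.2 hσt.le) ht.le]
  have := (Real.rpow_pos_of_pos ht (-α)).ne'
  field_simp

/-! ### The fractional flux -/

lemma fluxInt_temp (hα₀ : 0 < α) (hα₁ : α < 1) (hc : 0 < c) {a r : ℝ} (ha : 0 < a) (hr : 0 < r)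
    (h : a < front α c r) :
    fluxInt α (temp α c) (front α c) a r =
      -(r ^ (α / 2) * fluxTransform α (resolvent α c) (a * r ^ (-(α / 2)))) := by
  set σ := sInv (front α c) a with hσdef
  have hσ : 0 < σ := sInv_front_pos hα₀ hc ha
  have hσr : σ < r := (sInv_lt_iff hα₀ hc ha.le hr.le).2 h
  set f : ℝ → ℝ := fun τ => (r - τ) ^ (α - 1) *
    -(τ ^ (-(α / 2)) * resolvent α c (a * τ ^ (-(α / 2)))) with hf
  have h1 : fluxInt α (temp α c) (front α c) a r = ∫ τ in σ..r, f τ := by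
    refine intervalIntegral.integral_congr fun τ hτ => ?_
    rw [← hσdef, uIcc_of_le hσr.le] at hτ
    have hτ0 := hσ.trans_le hτ.1
    simp only [hf]
    rw [ux_temp hα₀ hα₁ hc hτ0 ⟨ha.le, (sInv_le_iff hα₀ hc ha.le hτ0.le).1 hτ.1⟩]
  -- Before the melting time `σ` the argument `a τ^(-α/2)` is at least `c` and the resolvent
  -- vanishes, so the integral may start at `0`.
  have h2 : ∫ τ in σ..r, f τ = ∫ τ in (0 : ℝ)..r, f τ := by
    rw [intervalIntegral.integral_of_le hσr.le, intervalIntegral.integral_of_le hr.le]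
    symm
    refine setIntegral_eq_of_subset_of_forall_sdiff_eq_zero measurableSet_Ioc
      (Ioc_subset_Ioc_left hσ.le) fun τ hτ => ?_
    have hτσ : τ ≤ σ := by
      by_contra! h'
      exact hτ.2 ⟨h', hτ.1.2⟩
    have : c ≤ a * τ ^ (-(α / 2)) := by
      by_contra! h'
      exact hτσ.not_gt ((sInv_lt_iff hα₀ hc ha.le hτ.1.1.le).2 ((mul_rpow_lt_iff hτ.1.1).1 h'))
    simp only [hf]
    rw [resolvent_of_le this]
    ring
  have h3 := intervalIntegral.mul_integral_comp_mul_left (a := 0) (b := 1) (f := f) r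
  rw [mul_zero, mul_one] at h3
  rw [h1, h2, ← h3, fluxTransform, ← intervalIntegral.integral_const_mul,
    ← intervalIntegral.integral_const_mul, ← intervalIntegral.integral_neg]
  refine intervalIntegral.integral_congr fun θ hθ => ?_
  rw [uIcc_of_le zero_le_one] at hθ
  have e : r - r * θ = r * (1 - θ) := by ring
  -- Powers from `τ = r θ`: one from `dτ`, `α - 1` from the Abel kernel, `-α/2` from `u_x`.
  have e4 : r ^ (α / 2) = r * (r ^ (α - 1) * r ^ (-(α / 2))) := by
    rw [← Real.rpow_add hr]
    nth_rw 2 [← Real.rpow_one r]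
    rw [← Real.rpow_add hr]
    congr 1
    ring
  simp only [hf, weight]
  rw [e, Real.mul_rpow hr.le (sub_nonneg.2 hθ.2), Real.mul_rpow hr.le hθ.1, e4]
  simp only [mul_assoc]
  ring

lemma hasDerivAt_fluxInt (hα₀ : 0 < α) (hα₁ : α < 1) (hc : 0 < c) {a t : ℝ} (ha : 0 < a)
    (ht : 0 < t) (h : a < front α c t) :
    HasDerivAt (fluxInt α (temp α c) (front α c) a)
      (-(α / 2 * t ^ (α / 2 - 1) * fluxTransform α (resolvent α c) (a * t ^ (-(α / 2))) +
        t ^ (α / 2) * ((Real.Gamma α + fluxRemainderDeriv α c (a * t ^ (-(α / 2)))) *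
          (a * (α / 2 * t ^ (-(α / 2) - 1)))))) t := by
  have hr : 0 < t ^ (-(α / 2)) := Real.rpow_pos_of_pos ht _
  have h1 := (hasDerivAt_fluxTransform hα₀ hα₁ (mul_pos ha hr) ((mul_rpow_lt_iff ht).2 h)).comp t
    ((hasDerivAt_rpow_neg_half (α := α) ht).const_mul a)
  have h2 := ((Real.hasDerivAt_rpow_const (p := α / 2) (Or.inl ht.ne')).mul h1).neg
  refine (h2.congr_deriv ?_).congr_of_eventuallyEq ?_
  · simp only [Function.comp_apply]
    ring
  · filter_upwards [Ioi_mem_nhds ht, (continuous_front hα₀).continuousAt.eventually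
      (lt_mem_nhds h)] with r hr hr'
    exact fluxInt_temp hα₀ hα₁ hc ha hr hr'

/-- As `a` tends to the front, the transform tends to `0` and its derivative to `-Γ(α)`, leaving
`(α/2) s(t)/t = s'(t)` whatever the value of `c`. -/
lemma tendsto_deriv_fluxInt (hα₀ : 0 < α) (hα₁ : α < 1) (hc : 0 < c) {t : ℝ} (ht : 0 < t) :
    Tendsto (fun a => -(1 / Real.Gamma α) * deriv (fluxInt α (temp α c) (front α c) a) t)
      (𝓝[<] (front α c t)) (𝓝 (deriv (front α c) t)) := by
  have hs := front_pos (α := α) hc ht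
  have hr : 0 < t ^ (-(α / 2)) := Real.rpow_pos_of_pos ht _
  have hΓ := (Real.Gamma_pos_of_pos hα₀).ne'
  have hid : Tendsto (fun a : ℝ => a) (𝓝[<] front α c t) (𝓝 (front α c t)) :=
    tendsto_id.mono_left nhdsWithin_le_nhds
  have hz0 : Tendsto (fun a : ℝ => a * t ^ (-(α / 2))) (𝓝[<] front α c t) (𝓝 c) := by
    simpa only [front_mul ht] using hid.mul_const (t ^ (-(α / 2)))
  have hz : Tendsto (fun a : ℝ => a * t ^ (-(α / 2))) (𝓝[<] front α c t) (𝓝[<] c) := by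
    refine tendsto_nhdsWithin_iff.2 ⟨hz0, ?_⟩
    filter_upwards [self_mem_nhdsWithin] with a ha
    exact (mul_rpow_lt_iff ht).2 ha
  have hF := (tendsto_fluxTransform hα₀ hα₁ hc).comp hz
  have hP := ((continuousAt_fluxRemainderDeriv hα₀ hα₁ hc hc).tendsto).comp hz0
  rw [fluxRemainderDeriv_self hα₀ hc] at hP
  have hlim := (((hF.const_mul (α / 2 * t ^ (α / 2 - 1))).add
    (((hP.const_add (Real.Gamma α)).mul
      (hid.mul_const (α / 2 * t ^ (-(α / 2) - 1)))).const_mul (t ^ (α / 2)))).neg).const_mul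
        (-(1 / Real.Gamma α))
  have hval : -(1 / Real.Gamma α) * -(α / 2 * t ^ (α / 2 - 1) * 0 + t ^ (α / 2) *
      ((Real.Gamma α + 0) * (front α c t * (α / 2 * t ^ (-(α / 2) - 1))))) =
      deriv (front α c) t := by
    rw [(hasDerivAt_front ht).deriv, front]
    have e1 : t ^ (α / 2) * t ^ (-(α / 2) - 1) = t ^ (-1 : ℝ) := by
      rw [← Real.rpow_add ht]
      congr 1
      ring
    have e2 : t ^ (α / 2 - 1) = t ^ (α / 2) * t ^ (-1 : ℝ) := by
      rw [← Real.rpow_add ht]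
      congr 1
    rw [e2, ← e1]
    field_simp
    ring
  rw [hval] at hlim
  refine hlim.congr' ?_
  filter_upwards [Ioo_mem_nhdsLT hs] with a ha
  rw [(hasDerivAt_fluxInt hα₀ hα₁ hc ha.1 ht ha.2).deriv]
  rfl

/-! ### The self-similar pair solves the free boundary problem -/

lemma continuousOn_temp (hα₀ : 0 < α) (hα₁ : α < 1) :
    ContinuousOn (fun q : ℝ × ℝ => temp α c q.1 q.2) (Uclosed (front α c)) := by
  refine (continuous_profile hα₀ hα₁).comp_continuousOn (continuousOn_fst.mul ?_)
  exact continuousOn_snd.rpow_const fun q hq => Or.inl (ne_of_gt hq.1)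

lemma isStefanSolution_temp (hα₀ : 0 < α) (hα₁ : α < 1) (hc : 0 < c) :
    IsStefanSolution α (temp α c) (front α c) where
  s_zero := front_zero hα₀
  s_cont := (continuous_front hα₀).continuousOn
  s_mono := strictMonoOn_front hα₀ hc
  s_diff t ht := (hasDerivAt_front ht).differentiableAt
  u_cont := continuousOn_temp hα₀ hα₁
  diff_x x t _ := (hasDerivAt_temp_space hα₀ hα₁ x t).differentiableAt
  diff_xx x t h := (hasDerivAt_ux hα₀ hα₁ hc h.1 h.2.1 h.2.2).differentiableAt
  diff_t x t h := (hasDerivAt_temp_time hα₀ hα₁ x h.1).differentiableAt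
  caputo_int x t h := by
    have hσt := (sInv_le_iff hα₀ hc h.2.1.le h.1.le).2 h.2.2.le
    refine (intervalIntegrable_sub_rpow (by linarith) _ _).mul_continuousOn
      ((continuousOn_ut_time hα₀ hα₁ hc h.2.1).mono ?_)
    rw [uIcc_of_le hσt]
    exact Icc_subset_Ici_self
  equation x t h := by
    obtain ⟨ht, hx, hlt⟩ := h
    rw [caputo_temp hα₀ hα₁ hc ht hx hlt, (hasDerivAt_ux hα₀ hα₁ hc ht hx hlt).deriv,
      ← kernel_front hα₀ hc ht hx hlt, profileDeriv₂]
    ring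
  front t ht := by rw [temp, front_mul ht, profile, intervalIntegral.integral_same]
  flux_int a t h := by
    have hσt := (sInv_le_iff hα₀ hc h.2.1.le h.1.le).2 h.2.2.le
    refine (intervalIntegrable_sub_rpow (by linarith) _ _).mul_continuousOn
      ((continuousOn_ux_time hα₀ hα₁ hc h.2.1).mono ?_)
    rw [uIcc_of_le hσt]
    exact Icc_subset_Ici_self
  flux_diff a t h := (hasDerivAt_fluxInt hα₀ hα₁ hc h.2.1 h.1 h.2.2).differentiableAt
  stefan t ht := tendsto_deriv_fluxInt hα₀ hα₁ hc ht

lemma neumann_temp (hα₀ : 0 < α) (hα₁ : α < 1) {β : ℝ} (hβ : resolvent α c 0 = β) :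
    Neumann α β (temp α c) (front α c) := by
  intro t _
  have h := hasDerivAt_temp_space (c := c) hα₀ hα₁ 0 t
  rw [zero_mul, hβ] at h
  exact (h.congr_deriv (by ring)).hasDerivWithinAt

lemma temp_eq (hα₀ : 0 < α) (hα₁ : α < 1) {x t : ℝ} (h : (x, t) ∈ Uclosed (front α c)) :
    temp α c x t = ∫ p in (x * t ^ (-(α / 2)))..c, H α p (x * t ^ (-(α / 2))) * G α c p := by
  obtain ⟨ht, hx, hle⟩ := h
  exact (integral_H_mul_G hα₀ hα₁ (mul_nonneg hx (Real.rpow_nonneg (le_of_lt ht) _))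
    ((mul_rpow_le_iff ht).2 hle)).symm

lemma temp_pos (hα₀ : 0 < α) (hα₁ : α < 1) {x t : ℝ} (h : (x, t) ∈ U (front α c)) :
    0 < temp α c x t := by
  obtain ⟨ht, hx, hlt⟩ := h
  exact profile_pos hα₀ hα₁ (mul_nonneg (le_of_lt hx) (Real.rpow_nonneg (le_of_lt ht) _))
    ((mul_rpow_lt_iff ht).2 hlt)

lemma scaled_rpow (hα₀ : 0 < α) {a l x t : ℝ} (hl : 0 < l) (ht : 0 < t) :
    l ^ a * x * (l ^ (2 * a / α) * t) ^ (-(α / 2)) = x * t ^ (-(α / 2)) := by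
  have e : 2 * a / α * -(α / 2) = -a := by field_simp
  rw [Real.mul_rpow (by positivity) ht.le, ← Real.rpow_mul hl.le, e, Real.rpow_neg hl.le]
  have := (Real.rpow_pos_of_pos hl a).ne'
  field_simp

lemma temp_scaling (hα₀ : 0 < α) {a l x t : ℝ} (hl : 0 < l)
    (h : (x, t) ∈ Uclosed (front α c)) :
    (l ^ a * x, l ^ (2 * a / α) * t) ∈ Uclosed (front α c) ∧
      temp α c x t = temp α c (l ^ a * x) (l ^ (2 * a / α) * t) := by
  obtain ⟨ht, hx, hle⟩ := h
  simp only at ht hx hle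
  have ht' : 0 < l ^ (2 * a / α) * t := by positivity
  refine ⟨⟨ht', by positivity, ?_⟩, ?_⟩
  · simp only
    rw [← mul_rpow_le_iff ht', scaled_rpow hα₀ hl ht]
    exact (mul_rpow_le_iff ht).2 hle
  · rw [temp, temp, scaled_rpow hα₀ hl ht]

lemma continuousOn_ux_space (hα₀ : 0 < α) (hα₁ : α < 1) (hc : 0 < c) {t : ℝ} (ht : 0 < t) :
    ContinuousOn (fun x => ux (temp α c) (front α c) x t) (Icc 0 (front α c t)) := by
  have hg := continuous_resolvent_right hα₀ hα₁ c
  have : Continuous fun x => -(t ^ (-(α / 2)) * resolvent α c (x * t ^ (-(α / 2)))) := by fun_prop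
  exact this.continuousOn.congr fun x hx => ux_temp hα₀ hα₁ hc ht hx

lemma ux_front (hα₀ : 0 < α) (hα₁ : α < 1) (hc : 0 < c) {t : ℝ} (ht : 0 < t) :
    ux (temp α c) (front α c) (front α c t) t = 0 := by
  rw [ux_temp hα₀ hα₁ hc ht ⟨(front_pos hc ht).le, le_rfl⟩, front_mul ht,
    resolvent_of_le le_rfl, mul_zero, neg_zero]

lemma hasDerivWithinAt_front (hα₀ : 0 < α) (hα₁ : α < 1) {t : ℝ} (ht : 0 < t) :
    HasDerivWithinAt (fun y => temp α c y t) 0 (Icc 0 (front α c t)) (front α c t) := by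
  have h := hasDerivAt_temp_space (c := c) hα₀ hα₁ (front α c t) t
  rw [front_mul ht, resolvent_of_le le_rfl, mul_zero, neg_zero] at h
  exact h.hasDerivWithinAt

lemma tendsto_ux_front (hα₀ : 0 < α) (hα₁ : α < 1) (hc : 0 < c) {t : ℝ} (ht : 0 < t) :
    Tendsto (fun x => ux (temp α c) (front α c) x t) (𝓝[<] (front α c t)) (𝓝 0) := by
  have hs := front_pos (α := α) hc ht
  have h := continuousOn_ux_space hα₀ hα₁ hc ht _ (right_mem_Icc.2 hs.le)
  rw [ContinuousWithinAt, ux_front hα₀ hα₁ hc ht] at h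
  exact h.mono_left (nhdsWithin_le_of_mem (Icc_mem_nhdsLT hs))

lemma ux_space_deriv_nonneg (hα₀ : 0 < α) (hα₁ : α < 1) (hc : 0 < c) {t : ℝ} (ht : 0 < t)
    (x : ℝ) : 0 ≤ t ^ (-α) * profileDeriv₂ α c (x * t ^ (-(α / 2))) :=
  mul_nonneg (Real.rpow_nonneg ht.le _) (profileDeriv₂_nonneg hα₀ hα₁ hc _)

lemma memW_temp (hα₀ : 0 < α) (hα₁ : α < 1) (hc : 0 < c) {t : ℝ} (ht : 0 < t) :
    MemW 2 1 0 (front α c t) (fun x => temp α c x t) := by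
  have hs := front_pos (α := α) hc ht
  have hd : ∀ x ∈ Ioo 0 (front α c t), HasDerivAt (fun x => ux (temp α c) (front α c) x t)
      (t ^ (-α) * profileDeriv₂ α c (x * t ^ (-(α / 2)))) x :=
    fun x hx => hasDerivAt_ux hα₀ hα₁ hc ht hx.1 hx.2
  refine memW_two_one hs.le
    (fun x _ => (hasDerivAt_temp_space hα₀ hα₁ x t).continuousAt.continuousWithinAt)
    (continuousOn_ux_space hα₀ hα₁ hc ht) (fun x hx => ?_) hd
    (intervalIntegrable_of_deriv_nonneg hs.le (continuousOn_ux_space hα₀ hα₁ hc ht) hd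
      fun x _ => ux_space_deriv_nonneg hα₀ hα₁ hc ht x)
  rw [ux_temp hα₀ hα₁ hc ht (Ioo_subset_Icc_self hx)]
  exact hasDerivAt_temp_space hα₀ hα₁ x t

lemma absolutelyContinuous_ux_space (hα₀ : 0 < α) (hα₁ : α < 1) (hc : 0 < c) {t : ℝ} (ht : 0 < t) :
    AbsolutelyContinuousOnInterval (fun x => ux (temp α c) (front α c) x t) 0 (front α c t) :=
  absolutelyContinuousOnInterval_of_deriv_nonneg (front_pos hc ht).le
    (continuousOn_ux_space hα₀ hα₁ hc ht)
    (fun _ hx => hasDerivAt_ux hα₀ hα₁ hc ht hx.1 hx.2)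
    fun x _ => ux_space_deriv_nonneg hα₀ hα₁ hc ht x

lemma absolutelyContinuous_ux_time (hα₀ : 0 < α) (hα₁ : α < 1) (hc : 0 < c) {x T : ℝ}
    (hx : 0 < x) (hT : sInv (front α c) x ≤ T) :
    AbsolutelyContinuousOnInterval (fun τ => ux (temp α c) (front α c) x τ)
      (sInv (front α c) x) T := by
  have hσ := sInv_front_pos hα₀ hc hx
  -- The factor `τ^(-α/2)` is smooth because `s⁻¹(x) > 0`. The other factor of `u_x` increases in
  -- `τ`, with a derivative singular at `τ = s⁻¹(x)`, so it is treated by the sign of its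
  -- derivative.
  have h1 : AbsolutelyContinuousOnInterval (fun τ : ℝ => τ ^ (-(α / 2)))
      (sInv (front α c) x) T := by
    refine ContDiffOn.absolutelyContinuousOnInterval fun τ hτ => ?_
    rw [uIcc_of_le hT] at hτ
    exact (Real.contDiffAt_rpow_const_of_ne (hσ.trans_le hτ.1).ne').contDiffWithinAt
  have h2 : AbsolutelyContinuousOnInterval
      (fun τ : ℝ => resolvent α c (x * τ ^ (-(α / 2)))) (sInv (front α c) x) T := by
    refine absolutelyContinuousOnInterval_of_deriv_nonneg hT
      ((continuousOn_resolvent_time hα₀ hα₁ x).mono fun τ hτ => hσ.trans_le hτ.1)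
      (f' := fun τ => profileDeriv₂ α c (x * τ ^ (-(α / 2))) *
        (x * (α / 2 * τ ^ (-(α / 2) - 1)))) (fun τ hτ => ?_) fun τ hτ => ?_
    · have hτ0 := hσ.trans hτ.1
      have h := (hasDerivAt_resolvent hα₀ hα₁ (mul_pos hx (Real.rpow_pos_of_pos hτ0 _))
        ((mul_rpow_lt_iff hτ0).2 ((sInv_lt_iff hα₀ hc hx.le hτ0.le).1 hτ.1))).comp τ
        ((hasDerivAt_rpow_neg_half (α := α) hτ0).const_mul x)
      exact h.congr_deriv (by ring)
    · have hτ0 := hσ.trans hτ.1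
      exact mul_nonneg (profileDeriv₂_nonneg hα₀ hα₁ hc _) (by positivity)
  refine absolutelyContinuousOnInterval_congr (h1.mul h2).neg fun τ hτ => ?_
  rw [uIcc_of_le hT] at hτ
  have hτ0 := hσ.trans_le hτ.1
  rw [ux_temp hα₀ hα₁ hc hτ0 ⟨hx.le, (sInv_le_iff hα₀ hc hx.le hτ0.le).1 hτ.1⟩]
  rfl

lemma memLp_top_ux_time (hα₀ : 0 < α) (hα₁ : α < 1) (hc : 0 < c) {x : ℝ} (hx : 0 < x) :
    MemLp (fun τ => ux (temp α c) (front α c) x τ) ∞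
      (volume.restrict (Ioi (sInv (front α c) x))) := by
  have hσ := sInv_front_pos hα₀ hc hx
  obtain ⟨B, hB0, hB⟩ := exists_resolvent_bound hα₀ hα₁ c
  refine memLp_top_of_bound (((continuousOn_ux_time hα₀ hα₁ hc hx).mono
    Ioi_subset_Ici_self).aestronglyMeasurable measurableSet_Ioi)
    (sInv (front α c) x ^ (-(α / 2)) * B) ?_
  filter_upwards [ae_restrict_mem measurableSet_Ioi] with τ hτ
  have hτ' : sInv (front α c) x < τ := hτ
  have hτ0 : 0 < τ := hσ.trans hτ'
  rw [ux_temp hα₀ hα₁ hc hτ0 ⟨hx.le, (sInv_le_iff hα₀ hc hx.le hτ0.le).1 hτ'.le⟩, norm_neg,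
    Real.norm_of_nonneg (mul_nonneg (by positivity) (resolvent_nonneg hα₀ hα₁ _ _))]
  exact mul_le_mul (Real.rpow_le_rpow_of_nonpos hσ hτ'.le (by linarith)) (hB _ (by positivity))
    (resolvent_nonneg hα₀ hα₁ _ _) (by positivity)

lemma integrableOn_ut_space (hα₀ : 0 < α) (hα₁ : α < 1) (hc : 0 < c) {t : ℝ} (ht : 0 < t) :
    IntegrableOn (fun x => ut (temp α c) (front α c) x t) (Ioo 0 (front α c t)) := by
  have hg := continuous_resolvent_right hα₀ hα₁ c
  have h : Continuous fun x =>
      α / 2 * x * t ^ (-(α / 2) - 1) * resolvent α c (x * t ^ (-(α / 2))) := by fun_prop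
  refine (h.integrableOn_Icc.mono_set Ioo_subset_Icc_self).congr_fun (fun x hx => ?_)
    measurableSet_Ioo
  exact (ut_temp hα₀ hα₁ ht ((sInv_le_iff hα₀ hc hx.1.le ht.le).2 hx.2.le)).symm

lemma integrableOn_caputo_space (hα₀ : 0 < α) (hα₁ : α < 1) (hc : 0 < c) {t : ℝ} (ht : 0 < t) :
    IntegrableOn (fun x => caputo α (temp α c) (front α c) x t) (Ioo 0 (front α c t)) := by
  have hr : 0 < t ^ (-(α / 2)) := Real.rpow_pos_of_pos ht _
  have h := ((intervalIntegrable_memory hα₀ hα₁ hc le_rfl hc.le).comp_mul_right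
    (c := t ^ (-(α / 2)))).const_mul (t ^ (-α))
  have e : c / t ^ (-(α / 2)) = front α c t := by
    rw [div_eq_iff hr.ne', front_mul ht]
  rw [zero_div, e, intervalIntegrable_iff_integrableOn_Ioo_of_le (front_pos hc ht).le] at h
  exact h.congr_fun (fun x hx => (caputo_temp hα₀ hα₁ hc ht hx.1 hx.2).symm) measurableSet_Ioo

lemma deriv_front_pos (hα₀ : 0 < α) (hc : 0 < c) {t : ℝ} (ht : 0 < t) :
    0 < c * (α / 2 * t ^ (α / 2 - 1)) := by
  positivity

lemma A1_front (hα₀ : 0 < α) (hc : 0 < c) (tstar : ℝ) : A1 (front α c) tstar := by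
  intro t ht
  refine ⟨(hasDerivAt_front ht.1).differentiableAt, ?_⟩
  rw [(hasDerivAt_front ht.1).deriv]
  exact deriv_front_pos hα₀ hc ht.1

lemma A2_temp (hα₀ : 0 < α) (hα₁ : α < 1) (hc : 0 < c) {tstar : ℝ} (h : 0 < tstar) :
    A2 (temp α c) (front α c) tstar := by
  refine ⟨?_, fun x hx hxs => ?_, fun t ht ε hε hεs => ?_, fun t ht => ?_⟩
  · exact absolutelyContinuousOnInterval_of_deriv_nonneg h.le (continuous_front hα₀).continuousOn
      (fun t ht => hasDerivAt_front ht.1) fun t ht => (deriv_front_pos hα₀ hc ht.1).le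
  · exact absolutelyContinuous_ux_time hα₀ hα₁ hc hx ((sInv_le_iff hα₀ hc hx.le h.le).2 hxs)
  · refine (absolutelyContinuous_ux_space hα₀ hα₁ hc ht.1).mono ?_
    rw [uIcc_of_le (by linarith), uIcc_of_le (by linarith)]
    exact Icc_subset_Icc_right (by linarith)
  · exact integrableOn_ut_space hα₀ hα₁ hc ht.1

lemma A3_temp (hα₀ : 0 < α) (hα₁ : α < 1) (hc : 0 < c) (tstar : ℝ) :
    A3 α (temp α c) (front α c) tstar := by
  refine ⟨fun K hK hKs => ?_, fun t ht => integrableOn_caputo_space hα₀ hα₁ hc ht.1⟩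
  have hcont : ContinuousOn (deriv (front α c)) K := by
    have h : ContinuousOn (fun t : ℝ => c * (α / 2 * t ^ (α / 2 - 1))) K :=
      continuousOn_const.mul ((continuousOn_mul_rpow (α / 2) _).mono fun t ht => (hKs ht).1)
    exact h.congr fun t ht => (hasDerivAt_front (hKs ht).1).deriv
  obtain ⟨B, hB⟩ := hK.exists_bound_of_continuousOn hcont
  refine memLp_top_of_bound (measurable_deriv _).aestronglyMeasurable B ?_
  filter_upwards [ae_restrict_mem hK.measurableSet] with t ht using hB t ht

end FracStefan

end

theorem corollary2 (α : ℝ) (hα₀ : 0 < α) (hα₁ : α < 1) :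
    -- the series defining `N` converges uniformly on every `W_R`; positivity of the kernels
    (∀ R : ℝ, 0 < R →
      TendstoUniformlyOn
        (fun (k : ℕ) (q : ℝ × ℝ) => ∑ n ∈ Finset.Icc 1 k, FracStefan.M α n q.1 q.2)
        (fun q : ℝ × ℝ => FracStefan.N α q.1 q.2) atTop
        {q : ℝ × ℝ | 0 ≤ q.2 ∧ q.2 ≤ q.1 ∧ q.1 ≤ R}) ∧
    (∀ p y : ℝ, 0 ≤ y → y < p →
      (∀ n : ℕ, 1 ≤ n → 0 < FracStefan.M α n p y) ∧ 0 < FracStefan.N α p y) ∧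
    -- existence of a self-similar solution for every Neumann datum
    ∀ β : ℝ, 0 < β → ∃ c₁ : ℝ, 0 < c₁ ∧ ∃ (u : ℝ → ℝ → ℝ) (s : ℝ → ℝ),
      FracStefan.IsStefanSolution α u s ∧
      FracStefan.Neumann α β u s ∧
      -- the explicit form
      (∀ t, 0 ≤ t → s t = c₁ * t ^ (α / 2)) ∧
      (∀ x t, (x, t) ∈ FracStefan.Uclosed s →
        u x t = ∫ p in (x * t ^ (-(α / 2)))..c₁,
          FracStefan.H α p (x * t ^ (-(α / 2))) * FracStefan.G α c₁ p) ∧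
      -- positivity
      (∀ x t, (x, t) ∈ FracStefan.U s → 0 < u x t) ∧
      -- scaling
      (∀ a l : ℝ, 0 < a → 0 < l → ∀ x t, (x, t) ∈ FracStefan.Uclosed s →
        (l ^ a * x, l ^ (2 * a / α) * t) ∈ FracStefan.Uclosed s ∧
        u x t = u (l ^ a * x) (l ^ (2 * a / α) * t)) ∧
      -- `u_x(s(t),t) = 0`, as a one-sided derivative and as a limit of interior values
      (∀ t, 0 < t →
        HasDerivWithinAt (fun y => u y t) 0 (Icc 0 (s t)) (s t) ∧
        Tendsto (fun x => FracStefan.ux u s x t) (𝓝[<] (s t)) (𝓝 0)) ∧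
      -- regularity
      (∀ t, 0 < t → FracStefan.MemW 2 1 0 (s t) (fun x => u x t)) ∧
      (∀ x, 0 < x →
        DifferentiableOn ℝ (fun τ => u x τ) (Ici (FracStefan.sInv s x)) ∧
        ContinuousOn (fun τ => FracStefan.ut u s x τ) (Ici (FracStefan.sInv s x))) ∧
      (∀ x, 0 < x →
        MemLp (fun τ => FracStefan.ux u s x τ) ∞
          (volume.restrict (Ioi (FracStefan.sInv s x))) ∧
        ∀ T, FracStefan.sInv s x < T →
          AbsolutelyContinuousOnInterval (fun τ => FracStefan.ux u s x τ)
            (FracStefan.sInv s x) T) ∧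
      (∀ t, 0 < t →
        IntegrableOn (fun x => FracStefan.ut u s x t) (Ioo 0 (s t)) ∧
        IntegrableOn (fun x => FracStefan.caputo α u s x t) (Ioo 0 (s t))) ∧
      (∀ tstar, 0 < tstar →
        FracStefan.A1 s tstar ∧ FracStefan.A2 u s tstar ∧
          FracStefan.A3 α u s tstar) := by
  refine ⟨fun R _ => FracStefan.tendstoUniformlyOn_N hα₀ hα₁ R,
    fun p y hy h => FracStefan.kernels_pos hα₀ hα₁ hy h, fun β hβ => ?_⟩
  obtain ⟨c, hc, hcβ⟩ := FracStefan.exists_resolvent_eq hα₀ hα₁ hβ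
  refine ⟨c, hc, FracStefan.temp α c, FracStefan.front α c,
    FracStefan.isStefanSolution_temp hα₀ hα₁ hc, FracStefan.neumann_temp hα₀ hα₁ hcβ,
    fun t _ => rfl, fun x t h => FracStefan.temp_eq hα₀ hα₁ h,
    fun x t h => FracStefan.temp_pos hα₀ hα₁ h,
    fun a l _ hl x t h => FracStefan.temp_scaling hα₀ hl h,
    fun t ht => ⟨FracStefan.hasDerivWithinAt_front hα₀ hα₁ ht,
      FracStefan.tendsto_ux_front hα₀ hα₁ hc ht⟩,
    fun t ht => FracStefan.memW_temp hα₀ hα₁ hc ht, fun x hx => ⟨fun τ hτ => ?_,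
      FracStefan.continuousOn_ut_time hα₀ hα₁ hc hx⟩,
    fun x hx => ⟨FracStefan.memLp_top_ux_time hα₀ hα₁ hc hx, fun T hT =>
      FracStefan.absolutelyContinuous_ux_time hα₀ hα₁ hc hx hT.le⟩,
    fun t ht => ⟨FracStefan.integrableOn_ut_space hα₀ hα₁ hc ht,
      FracStefan.integrableOn_caputo_space hα₀ hα₁ hc ht⟩,
    fun tstar h => ⟨FracStefan.A1_front hα₀ hc tstar, FracStefan.A2_temp hα₀ hα₁ hc h,
      FracStefan.A3_temp hα₀ hα₁ hc tstar⟩⟩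
  exact (FracStefan.hasDerivAt_temp_time hα₀ hα₁ x
    ((FracStefan.sInv_front_pos hα₀ hc hx).trans_le hτ)).differentiableAt.differentiableWithinAt
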